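/- Let $(\Omega,\mathcal F,P)$ be a probability space and let $T:S^2\times\Omega\to\mathbb R$ be a jointly measurable, zero-mean Gaussian field on the unit sphere $S^2\subset\mathbb R^3$ that is isotropic: for all $k$, all $x_1,\dots,x_k\in S^2$ and all $g\in SO(3)$, the vectors $(T(x_1),\dots,T(x_k))$ and $(T(gx_1),\dots,T(gx_k))$ have the same law. Let $\{Y_{\ell m}\}_{\ell\ge 0,\,-\ell\le m\le\ell}$ be an orthonormal system, with respect to the surface area measure $\sigma$ on $S^2$, such that for each $\ell$ the functions $Y_{\ell m}$, $-\ell\le m\le\ell$, form a basis of the complex spherical harmonics of degree $\ell$. Put $a_{\ell m}=\int_{S^2}T\,\overline{Y_{\ell m}}\,d\sigma$, and let $C_\ell=E|a_{\ell m}|^2$ be the angular power spectrum of $T$ (by isotropy this does not depend on $m$). Assume that there are $\alpha>2$, a rational function $G$ and constants $0<c_1<c_2<\infty$ such that $C_\ell=G(\ell)\,\ell^{-\alpha}$ and $c_1<G(\ell)<c_2$ for all sufficiently large $\ell$. Let $b:\mathbb R\to\mathbb R$ be a $C^\infty$ function with support in $[\tfrac12,2]$, put $\ell_j=2^j$, and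 define $$\beta_j(x)=\sum_{\ell=2^{j-1}}^{2^{j+1}}\sum_{m=-\ell}^{\ell}b\Big(\frac{\ell}{2^j}\Big)a_{\ell m}Y_{\ell m}(x),\qquad \widetilde\beta_j(x)=\frac{\beta_j(x)}{\sqrt{\sum_{\ell=2^{j-1}}^{2^{j+1}}b^2\big(\frac{\ell}{2^j}\big)\frac{2\ell+1}{4\pi}C_\ell}},$$ with the convention $\widetilde\beta_j\equiv 0$ if the denominator vanishes (which, if $b\not\equiv0$, can happen only for finitely many $j$). Then: (i) There is a constant $c>0$ such that for every integer $j\ge 1$ the variable $\sup_{x\in S^2}\widetilde\beta_j(x)$ is integrable and $$E\Big\{\sup_{x\in S^2}\widetilde\beta_j(x)\Big\}\le c\sqrt{4\log\ell_j}.$$ (ii) There is a constant $C>0$ such that $$P\left(\limsup_{j\to\infty}\frac{\sup_{x\in S^2}\widetilde\beta_j(x)}{\sqrt{4\log\ell_j}}\le C+\frac1{\sqrt2}\right)=1.$$ -/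

import Mathlib

open MeasureTheory ProbabilityTheory Filter
open scoped ComplexConjugate

noncomputable section

namespace SphericalField

/-- Euclidean three-space. -/
abbrev E3 : Type := EuclideanSpace ℝ (Fin 3)

/-- The unit sphere `S²` in `ℝ³`. -/
abbrev S2 : Type := Metric.sphere (0 : E3) 1

/-- The surface area measure on `S²` (total mass `4π`). -/
def sigma : Measure S2 := (volume : Measure E3).toSphere

/-- The action on `S²` of a linear isometry of `ℝ³`. -/
def moveSphere (g : E3 ≃ₗᵢ[ℝ] E3) (x : S2) : S2 :=
  ⟨g (x : E3), by simp⟩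

/-- `g` belongs to `SO(3)`. -/
def IsRotation (g : E3 ≃ₗᵢ[ℝ] E3) : Prop :=
  LinearMap.det (g.toLinearEquiv : E3 →ₗ[ℝ] E3) = 1

/-- The Laplacian `∂₀² + ∂₁² + ∂₂²` of a polynomial in three variables. -/
def polyLaplacian (p : MvPolynomial (Fin 3) ℂ) : MvPolynomial (Fin 3) ℂ :=
  ∑ i : Fin 3, MvPolynomial.pderiv i (MvPolynomial.pderiv i p)

/-- `f` is a spherical harmonic of degree `l`: the restriction to `S²` of a homogeneous harmonic
polynomial of degree `l`. These are the eigenfunctions of the spherical Laplacian with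
eigenvalue `-l(l+1)`. -/
def IsSphericalHarmonic (l : ℕ) (f : S2 → ℂ) : Prop :=
  ∃ p : MvPolynomial (Fin 3) ℂ, p.IsHomogeneous l ∧ polyLaplacian p = 0 ∧
    ∀ x : S2, f x = MvPolynomial.eval (fun i => (((x : E3) i : ℝ) : ℂ)) p

/-- `Y l m` (`l ≥ 0`, `-l ≤ m ≤ l`) is an orthonormal system of spherical harmonics, such that for
each `l` the `2l+1` functions `Y l m` are a basis of the spherical harmonics of degree `l`.
The values `Y l m` for `|m| > l` play no role. -/
structure IsSphericalHarmonicBasis (Y : ℕ → ℤ → S2 → ℂ) : Prop where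
  harmonic : ∀ l : ℕ, ∀ m ∈ Finset.Icc (-(l : ℤ)) l, IsSphericalHarmonic l (Y l m)
  orthonormal : ∀ l : ℕ, ∀ m ∈ Finset.Icc (-(l : ℤ)) l,
    ∀ l' : ℕ, ∀ m' ∈ Finset.Icc (-(l' : ℤ)) l',
      ∫ x, Y l m x * conj (Y l' m' x) ∂sigma = if l = l' ∧ m = m' then 1 else 0
  spanning : ∀ l : ℕ, ∀ f : S2 → ℂ, IsSphericalHarmonic l f →
    ∃ a : ℤ → ℂ, ∀ x, f x = ∑ m ∈ Finset.Icc (-(l : ℤ)) l, a m * Y l m x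

/-- A jointly measurable, zero mean, isotropic Gaussian random field on `S²`. -/
structure IsIsotropicGaussianField {Ω : Type*} [MeasurableSpace Ω]
    (T : S2 → Ω → ℝ) (P : Measure Ω) : Prop where
  measurable : Measurable (Function.uncurry T)
  gaussian : IsGaussianProcess T P
  mean_zero : ∀ x, ∫ ω, T x ω ∂P = 0
  isotropic : ∀ g : E3 ≃ₗᵢ[ℝ] E3, IsRotation g → ∀ (k : ℕ) (x : Fin k → S2),
    P.map (fun ω i => T (moveSphere g (x i)) ω) = P.map (fun ω i => T (x i) ω)

/-- The random coefficient `a_{lm} = ∫ T(x) conj(Y_{lm}(x)) dσ(x)`. -/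
def coeff {Ω : Type*} (T : S2 → Ω → ℝ) (Y : ℕ → ℤ → S2 → ℂ) (l : ℕ) (m : ℤ) (ω : Ω) : ℂ :=
  ∫ x, (T x ω : ℂ) * conj (Y l m x) ∂sigma

/-- The angular power spectrum `C_l`: the common value of `E|a_{lm}|²`, `-l ≤ m ≤ l`, written
as the average over `m` (for an isotropic field the `2l+1` terms are equal). -/
def powerSpectrum {Ω : Type*} [MeasurableSpace Ω] (P : Measure Ω) (T : S2 → Ω → ℝ)
    (Y : ℕ → ℤ → S2 → ℂ) (l : ℕ) : ℝ :=
  (∑ m ∈ Finset.Icc (-(l : ℤ)) l, ∫ ω, ‖coeff T Y l m ω‖ ^ 2 ∂P) / (2 * l + 1)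

/-- The band-limited field `β_j(x) = ∑_{l = 2^{j-1}}^{2^{j+1}} ∑_m b(l/2^j) a_{lm} Y_{lm}(x)`.
The sum is real (for each `l`, the sum over `m` is the value at `x` of the orthogonal projection of
a real function to a space closed under conjugation); `re` only records this in the type. -/
def needletField {Ω : Type*} (b : ℝ → ℝ) (T : S2 → Ω → ℝ) (Y : ℕ → ℤ → S2 → ℂ)
    (j : ℕ) (x : S2) (ω : Ω) : ℝ :=
  (∑ l ∈ Finset.Icc ((2 : ℕ) ^ (j - 1)) (2 ^ (j + 1)), ∑ m ∈ Finset.Icc (-(l : ℤ)) l,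
    (b ((l : ℝ) / 2 ^ j) : ℂ) * coeff T Y l m ω * Y l m x).re

/-- The normalizing variance `∑_l b²(l/2^j) (2l+1)/(4π) C_l`. -/
def needletVariance {Ω : Type*} [MeasurableSpace Ω] (P : Measure Ω) (b : ℝ → ℝ)
    (T : S2 → Ω → ℝ) (Y : ℕ → ℤ → S2 → ℂ) (j : ℕ) : ℝ :=
  ∑ l ∈ Finset.Icc ((2 : ℕ) ^ (j - 1)) (2 ^ (j + 1)),
    b ((l : ℝ) / 2 ^ j) ^ 2 * ((2 * (l : ℝ) + 1) / (4 * Real.pi)) * powerSpectrum P T Y l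

/-- The normalized field `β̃_j = β_j / √(∑_l b²(l/2^j) (2l+1)/(4π) C_l)`; it is `0` if the
normalizing variance vanishes. -/
def normalizedField {Ω : Type*} [MeasurableSpace Ω] (P : Measure Ω) (b : ℝ → ℝ)
    (T : S2 → Ω → ℝ) (Y : ℕ → ℤ → S2 → ℂ) (j : ℕ) (x : S2) (ω : Ω) : ℝ :=
  needletField b T Y j x ω / √(needletVariance P b T Y j)

/-- `C_l = G(l) l^{-α}` for all large `l`, where `α > 2` and `G` is a rational function
(a quotient of two real polynomials) with `0 < c₁ < G(l) < c₂ < ∞`. -/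
def HasRegularSpectrum (C : ℕ → ℝ) : Prop :=
  ∃ (α : ℝ) (p q : Polynomial ℝ) (c₁ c₂ : ℝ), 2 < α ∧ 0 < c₁ ∧
    ∀ᶠ l : ℕ in atTop, q.eval (l : ℝ) ≠ 0 ∧
      c₁ < p.eval (l : ℝ) / q.eval (l : ℝ) ∧ p.eval (l : ℝ) / q.eval (l : ℝ) < c₂ ∧
      C l = p.eval (l : ℝ) / q.eval (l : ℝ) * (l : ℝ) ^ (-α)

end SphericalField

end

/-!
The constants of the theorem are free, so it suffices to bound the moment of order `2j` of
`S_j = sup_x β̃_j(x)` by `(B j) ^ j` with `B` independent of `j`. From this,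
`S ≤ r (1 + (S / r) ^ (2j))` with `r = √(B j)` gives `E S_j ≤ 2 √(B j)`, and Markov's inequality
gives `P (S_j ≥ 2 √(B j)) ≤ 4 ^ (-j)`, so that the Borel–Cantelli lemma applies
(`integral_le_two_mul_of_lintegral_pow_le`, `ae_eventually_lt_of_lintegral_pow_le`).

The moment bound has three ingredients.

* A Nikolskii inequality (`norm_polyRestrict_pow_mul_le`). The space of polynomials of degree at
  most `D` on the sphere is rotation invariant, so its reproducing kernel is constant on the
  diagonal, and `|q(x)|² σ(S²) ≤ dim · ∫ |q|² dσ`. Applied to `q ^ k`, this bounds the sup norm by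
  the `L^{2k}` norm with the constant `dim ^ (1/2k)`. Trajectories of `β̃_j` have degree at most
  `2 ^ (j + 1)`; with `k = j` the constant stays bounded in `j`. This replaces the usual chaining
  or discretization argument.
* Gaussian moments (`IsCenteredGaussian.lintegral_integral_pow_le`). An integral of the process
  against a bounded weight lies in the closed linear span of the process in `L²(P)`. On the span
  the moment of order `2k` is at most `(12k) ^ k` times the `k`-th power of the variance, and by
  Fatou's lemma this passes to the closure.
* The variance of `β_j(x)` (`IsIsotropicGaussianField.integral_needletField_sq_mul_le`). The
  kernel `∑_m Y_{lm}(x) conj Y_{lm}(y)` is rotation invariant because the harmonics of degree `l`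
  form a rotation-invariant space, and `T` is isotropic; so the variance does not depend on `x`.
  Its integral over the sphere is computed by Parseval's identity.
-/

noncomputable section

namespace SphericalField

/-! ### Rotations of the sphere -/

instance : IsFiniteMeasure sigma := by unfold sigma; infer_instance

instance : sigma.IsOpenPosMeasure := by unfold sigma; infer_instance

instance : Nonempty S2 := ⟨⟨EuclideanSpace.single 0 1, by simp⟩⟩

lemma continuous_moveSphere (g : E3 ≃ₗᵢ[ℝ] E3) : Continuous (moveSphere g) :=
  (g.continuous.comp continuous_subtype_val).subtype_mk _

/-- The action of a linear isometry on the sphere, as a homeomorphism. -/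
def sphereHomeomorph (g : E3 ≃ₗᵢ[ℝ] E3) : S2 ≃ₜ S2 where
  toFun := moveSphere g
  invFun := moveSphere g.symm
  left_inv x := by ext1; simp [moveSphere]
  right_inv x := by ext1; simp [moveSphere]
  continuous_toFun := continuous_moveSphere g
  continuous_invFun := continuous_moveSphere g.symm

open scoped Pointwise in
lemma measurePreserving_moveSphere (g : E3 ≃ₗᵢ[ℝ] E3) :
    MeasurePreserving (moveSphere g) sigma sigma := by
  refine ⟨(continuous_moveSphere g).measurable, ?_⟩
  ext s hs
  have hs' : MeasurableSet (moveSphere g ⁻¹' s) := (continuous_moveSphere g).measurable hs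
  rw [Measure.map_apply (continuous_moveSphere g).measurable hs]
  unfold sigma
  rw [Measure.toSphere_apply' _ hs, Measure.toSphere_apply' _ hs']
  congr 1
  -- the cone over the preimage is the preimage of the cone, and `g` preserves Lebesgue measure
  have : g ⁻¹' (Set.Ioo (0 : ℝ) 1 • (Subtype.val '' s)) =
      Set.Ioo (0 : ℝ) 1 • (Subtype.val '' (moveSphere g ⁻¹' s)) := by
    ext v
    simp only [Set.mem_preimage, Set.mem_smul, Set.mem_image]
    constructor
    · rintro ⟨r, hr, _, ⟨w, hw, rfl⟩, h⟩
      have hg : moveSphere g (moveSphere g.symm w) = w := by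
        ext1; simp [moveSphere]
      refine ⟨r, hr, _, ⟨moveSphere g.symm w, by rwa [hg], rfl⟩, ?_⟩
      apply g.injective
      rw [← h, map_smul]
      simp [moveSphere]
    · rintro ⟨r, hr, _, ⟨w, hw, rfl⟩, rfl⟩
      exact ⟨r, hr, _, ⟨moveSphere g w, hw, rfl⟩, by simp [moveSphere]⟩
  rw [← this]
  exact g.measurePreserving.measure_preimage_equiv (f := g.toHomeomorph.toMeasurableEquiv) _

lemma isRotation_reflection_trans_reflection {u v : E3} (hu : u ≠ 0) (hv : v ≠ 0) :
    IsRotation ((ℝ ∙ u)ᗮ.reflection.trans (ℝ ∙ v)ᗮ.reflection) := by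
  have key : ∀ w : E3, w ≠ 0 →
      LinearMap.det ((ℝ ∙ w)ᗮ.reflection.toLinearMap) = -1 := by
    intro w hw
    rw [Submodule.det_reflection, Submodule.orthogonal_orthogonal, finrank_span_singleton hw]
    simp
  unfold IsRotation
  have : (((ℝ ∙ u)ᗮ.reflection.trans (ℝ ∙ v)ᗮ.reflection).toLinearEquiv : E3 →ₗ[ℝ] E3) =
      (ℝ ∙ v)ᗮ.reflection.toLinearMap ∘ₗ (ℝ ∙ u)ᗮ.reflection.toLinearMap := rfl
  rw [this, LinearMap.det_comp, key u hu, key v hv]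
  norm_num

/-- `SO(3)` acts transitively on the sphere: the reflection exchanging `x` and `y`, followed by a
reflection that fixes `y`, is a rotation taking `x` to `y`. -/
lemma exists_isRotation_moveSphere_eq (x y : S2) :
    ∃ g : E3 ≃ₗᵢ[ℝ] E3, IsRotation g ∧ moveSphere g x = y := by
  by_cases hxy : x = y
  · exact ⟨LinearIsometryEquiv.refl ℝ E3, by
      simp [IsRotation], by ext1; simp [moveSphere, hxy]⟩
  have hsub : (x : E3) - y ≠ 0 := fun h => hxy (Subtype.ext (sub_eq_zero.1 h))
  obtain ⟨v, hv, hv0⟩ : ∃ v ∈ (ℝ ∙ (y : E3))ᗮ, v ≠ 0 := by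
    apply Submodule.exists_mem_ne_zero_of_ne_bot
    intro h
    have h1 := Submodule.finrank_add_finrank_orthogonal (ℝ ∙ (y : E3))
    rw [h, finrank_bot] at h1
    have h2 := finrank_span_le_card (R := ℝ) ({(y : E3)} : Set E3)
    simp at h1 h2
    omega
  refine ⟨_, isRotation_reflection_trans_reflection hsub hv0, ?_⟩
  ext1
  have hn : ‖(x : E3)‖ = ‖(y : E3)‖ := by simp
  simp only [moveSphere, LinearIsometryEquiv.trans_apply]
  rw [Submodule.reflection_sub hn, Submodule.reflection_eq_self_iff]
  rw [Submodule.mem_orthogonal_singleton_iff_inner_right] at hv ⊢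
  rwa [real_inner_comm]

/-! ### Polynomial functions on the sphere -/

/-- The restriction to the sphere of a polynomial in the three coordinates. -/
def polyRestrict : MvPolynomial (Fin 3) ℂ →ₗ[ℂ] C(S2, ℂ) where
  toFun p := ⟨fun x => MvPolynomial.eval (fun i => (((x : E3) i : ℝ) : ℂ)) p, by
    refine (MvPolynomial.continuous_eval p).comp ?_
    fun_prop⟩
  map_add' p q := by ext; simp
  map_smul' c p := by ext; simp

lemma polyRestrict_apply (p : MvPolynomial (Fin 3) ℂ) (x : S2) :
    polyRestrict p x = MvPolynomial.eval (fun i => (((x : E3) i : ℝ) : ℂ)) p := rfl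

/-- The matrix of a linear isometry in the standard basis. -/
def isometryMatrix (g : E3 ≃ₗᵢ[ℝ] E3) (i j : Fin 3) : ℝ := g (EuclideanSpace.single j 1) i

lemma apply_eq_sum_isometryMatrix (g : E3 ≃ₗᵢ[ℝ] E3) (x : E3) (i : Fin 3) :
    g x i = ∑ j, isometryMatrix g i j * x j := by
  have hx : x = ∑ j, x j • EuclideanSpace.single j (1 : ℝ) := by
    ext k
    simp [Fin.sum_univ_three]
    fin_cases k <;> simp
  conv_lhs => rw [hx]
  rw [map_sum]
  simp [isometryMatrix, mul_comm]

/-- The rows of the matrix of an isometry are orthonormal. -/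
lemma sum_isometryMatrix_mul (g : E3 ≃ₗᵢ[ℝ] E3) (i i' : Fin 3) :
    ∑ k, isometryMatrix g i k * isometryMatrix g i' k = if i = i' then 1 else 0 := by
  have h : ∀ i k, isometryMatrix g i k = g.symm (EuclideanSpace.single i 1) k := by
    intro i k
    have h1 : inner ℝ (EuclideanSpace.single i (1 : ℝ)) (g (EuclideanSpace.single k 1)) =
        inner ℝ (g.symm (EuclideanSpace.single i (1 : ℝ))) (EuclideanSpace.single k 1) := by
      rw [← g.inner_map_map (g.symm _), g.apply_symm_apply]
    rw [EuclideanSpace.inner_single_left, EuclideanSpace.inner_single_right] at h1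
    simpa [isometryMatrix] using h1
  have h2 := g.symm.inner_map_map (EuclideanSpace.single i (1 : ℝ)) (EuclideanSpace.single i' 1)
  rw [EuclideanSpace.inner_single_left] at h2
  simp only [h]
  rw [PiLp.inner_apply] at h2
  simpa [Pi.single_apply, mul_comm] using h2

/-- The substitution `p ↦ p ∘ g` on polynomials. -/
def rotatePoly (g : E3 ≃ₗᵢ[ℝ] E3) : MvPolynomial (Fin 3) ℂ →ₐ[ℂ] MvPolynomial (Fin 3) ℂ :=
  MvPolynomial.aeval fun i =>
    ∑ j, MvPolynomial.C (isometryMatrix g i j : ℂ) * MvPolynomial.X j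

lemma rotatePoly_X (g : E3 ≃ₗᵢ[ℝ] E3) (i : Fin 3) :
    rotatePoly g (MvPolynomial.X i) =
      ∑ j, MvPolynomial.C (isometryMatrix g i j : ℂ) * MvPolynomial.X j := by
  simp [rotatePoly]

lemma polyRestrict_rotatePoly (g : E3 ≃ₗᵢ[ℝ] E3) (p : MvPolynomial (Fin 3) ℂ) (x : S2) :
    polyRestrict (rotatePoly g p) x = polyRestrict p (moveSphere g x) := by
  simp only [polyRestrict_apply]
  induction p using MvPolynomial.induction_on with
  | C a => simp [rotatePoly]
  | add p q hp hq => simp only [map_add, hp, hq]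
  | mul_X p i hp =>
    rw [map_mul, map_mul, map_mul, hp, rotatePoly_X, map_sum, MvPolynomial.eval_X]
    congr 1
    rw [show ((moveSphere g x : S2) : E3) = g x from rfl, apply_eq_sum_isometryMatrix]
    simp

lemma isHomogeneous_rotatePoly (g : E3 ≃ₗᵢ[ℝ] E3) {p : MvPolynomial (Fin 3) ℂ} {n : ℕ}
    (hp : p.IsHomogeneous n) : (rotatePoly g p).IsHomogeneous n := by
  have := hp.aeval (fun i => ∑ j, MvPolynomial.C (isometryMatrix g i j : ℂ) *
    MvPolynomial.X (R := ℂ) j) (n := 1) fun i => MvPolynomial.IsHomogeneous.sum _ _ _ fun j _ => by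
      simpa using (MvPolynomial.isHomogeneous_C _ _).mul (MvPolynomial.isHomogeneous_X ℂ j)
  rwa [one_mul] at this

/-- Each monomial of `p` is sent to a homogeneous polynomial of the same degree. -/
lemma totalDegree_rotatePoly_le (g : E3 ≃ₗᵢ[ℝ] E3) (p : MvPolynomial (Fin 3) ℂ) :
    (rotatePoly g p).totalDegree ≤ p.totalDegree := by
  conv_lhs => rw [p.as_sum, map_sum]
  refine MvPolynomial.totalDegree_finsetSum_le fun d hd => ?_
  refine ((isHomogeneous_rotatePoly g
    (MvPolynomial.isHomogeneous_monomial (n := d.degree) _ rfl)).totalDegree_le).trans ?_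
  exact MvPolynomial.le_totalDegree hd

/-- The chain rule for an orthogonal substitution. -/
lemma pderiv_rotatePoly (g : E3 ≃ₗᵢ[ℝ] E3) (k : Fin 3) (p : MvPolynomial (Fin 3) ℂ) :
    MvPolynomial.pderiv k (rotatePoly g p) =
      ∑ i, MvPolynomial.C (isometryMatrix g i k : ℂ) *
        rotatePoly g (MvPolynomial.pderiv i p) := by
  induction p using MvPolynomial.induction_on with
  | C a => simp [rotatePoly]
  | add p q hp hq => simp only [map_add, hp, hq, mul_add, Finset.sum_add_distrib]
  | mul_X p i hp =>
    have hX : MvPolynomial.pderiv k (rotatePoly g (MvPolynomial.X i)) =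
        MvPolynomial.C (isometryMatrix g i k : ℂ) := by
      rw [rotatePoly_X, map_sum, Finset.sum_eq_single k]
      · rw [MvPolynomial.pderiv_C_mul, MvPolynomial.pderiv_X_self, mul_one]
      · intro j _ hj
        rw [MvPolynomial.pderiv_C_mul, MvPolynomial.pderiv_X_of_ne hj, mul_zero]
      · simp
    have hR : ∀ j, MvPolynomial.C (isometryMatrix g j k : ℂ) *
        rotatePoly g (MvPolynomial.pderiv j (p * MvPolynomial.X i)) =
        rotatePoly g p * (if j = i then MvPolynomial.C (isometryMatrix g j k : ℂ) else 0) +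
        rotatePoly g (MvPolynomial.X i) * (MvPolynomial.C (isometryMatrix g j k : ℂ) *
          rotatePoly g (MvPolynomial.pderiv j p)) := by
      intro j
      rw [MvPolynomial.pderiv_mul, map_add, map_mul, map_mul]
      by_cases h : j = i
      · subst h
        rw [MvPolynomial.pderiv_X_self, map_one, if_pos rfl]
        ring
      · rw [MvPolynomial.pderiv_X_of_ne (Ne.symm h), map_zero, if_neg h]
        ring
    rw [Finset.sum_congr rfl fun j _ => hR j, map_mul, MvPolynomial.pderiv_mul, hp, hX,
      Finset.sum_add_distrib, ← Finset.mul_sum, ← Finset.mul_sum, Finset.sum_ite_eq' Finset.univ]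
    simp only [Finset.mem_univ, if_true]
    ring

lemma polyLaplacian_rotatePoly (g : E3 ≃ₗᵢ[ℝ] E3) (p : MvPolynomial (Fin 3) ℂ) :
    polyLaplacian (rotatePoly g p) = rotatePoly g (polyLaplacian p) := by
  have horth : ∀ i i' : Fin 3, ∑ k, (MvPolynomial.C (isometryMatrix g i k : ℂ) *
      MvPolynomial.C (isometryMatrix g i' k : ℂ) : MvPolynomial (Fin 3) ℂ) =
      if i = i' then 1 else 0 := by
    intro i i'
    have := congrArg (fun r : ℝ => (MvPolynomial.C (r : ℂ) : MvPolynomial (Fin 3) ℂ))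
      (sum_isometryMatrix_mul g i i')
    simp only [Complex.ofReal_sum, Complex.ofReal_mul, map_sum, map_mul] at this
    rw [this]
    split_ifs <;> simp
  unfold polyLaplacian
  simp only [pderiv_rotatePoly, map_sum, MvPolynomial.pderiv_C_mul, Finset.mul_sum]
  rw [Finset.sum_comm]
  refine Finset.sum_congr rfl fun i _ => ?_
  rw [Finset.sum_comm]
  have : ∀ i' k, MvPolynomial.C (isometryMatrix g i k : ℂ) *
      (MvPolynomial.C (isometryMatrix g i' k : ℂ) *
        rotatePoly g (MvPolynomial.pderiv i' (MvPolynomial.pderiv i p))) =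
      (MvPolynomial.C (isometryMatrix g i k : ℂ) * MvPolynomial.C (isometryMatrix g i' k : ℂ)) *
        rotatePoly g (MvPolynomial.pderiv i' (MvPolynomial.pderiv i p)) :=
    fun i' k => (mul_assoc _ _ _).symm
  simp only [this, ← Finset.sum_mul, horth]
  simp

lemma IsSphericalHarmonic.comp_moveSphere {l : ℕ} {f : S2 → ℂ} (hf : IsSphericalHarmonic l f)
    (g : E3 ≃ₗᵢ[ℝ] E3) : IsSphericalHarmonic l (f ∘ moveSphere g) := by
  obtain ⟨p, hp, hL, hfp⟩ := hf
  refine ⟨rotatePoly g p, isHomogeneous_rotatePoly g hp, ?_, fun x => ?_⟩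
  · rw [polyLaplacian_rotatePoly, hL, map_zero]
  · rw [Function.comp_apply, hfp]
    exact (polyRestrict_rotatePoly g p x).symm

/-! ### Finite orthonormal families and the Nikolskii inequality -/

/-- A family of continuous functions on the sphere, orthonormal in `L²(σ)`. -/
def IsOrthonormalFamily {ι : Type*} [DecidableEq ι] (e : ι → C(S2, ℂ)) : Prop :=
  ∀ i j, ∫ x, e i x * conj (e j x) ∂sigma = if i = j then 1 else 0

lemma integrable_of_continuous {F : Type*} [NormedAddCommGroup F] {f : S2 → F}
    (hf : Continuous f) : Integrable f sigma :=
  hf.integrable_of_hasCompactSupport (HasCompactSupport.of_compactSpace f)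

section Family

variable {ι : Type*} [Fintype ι] [DecidableEq ι] {e : ι → C(S2, ℂ)}

lemma IsOrthonormalFamily.integral_sum_mul_conj_sum (he : IsOrthonormalFamily e) (c d : ι → ℂ) :
    ∫ x, (∑ i, c i * e i x) * conj (∑ i, d i * e i x) ∂sigma = ∑ i, c i * conj (d i) := by
  have h : ∀ x, (∑ i, c i * e i x) * conj (∑ i, d i * e i x) =
      ∑ i, ∑ j, (c i * conj (d j)) * (e i x * conj (e j x)) := by
    intro x
    rw [map_sum, Finset.sum_mul_sum]
    refine Finset.sum_congr rfl fun i _ => Finset.sum_congr rfl fun j _ => ?_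
    rw [map_mul]
    ring
  simp only [h]
  rw [integral_finsetSum _ fun i _ => integrable_of_continuous (by fun_prop)]
  refine Finset.sum_congr rfl fun i _ => ?_
  rw [integral_finsetSum _ fun j _ => integrable_of_continuous (by fun_prop)]
  simp only [integral_const_mul, he i]
  simp

lemma IsOrthonormalFamily.integral_norm_sum_sq (he : IsOrthonormalFamily e) (c : ι → ℂ) :
    ∫ x, ‖∑ i, c i * e i x‖ ^ 2 ∂sigma = ∑ i, ‖c i‖ ^ 2 := by
  have h := he.integral_sum_mul_conj_sum c c
  simp only [Complex.mul_conj'] at h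
  rw [← Complex.ofReal_inj, Complex.ofReal_sum, ← integral_complex_ofReal]
  simpa using h

/-- If composition with an isometry maps the span of a finite orthonormal family into itself, then
the coefficient matrix is unitary, and the reproducing kernel of the family is invariant. -/
lemma IsOrthonormalFamily.kernel_moveSphere (he : IsOrthonormalFamily e) (g : E3 ≃ₗᵢ[ℝ] E3)
    (hg : ∀ i, ∃ u : ι → ℂ, ∀ x, e i (moveSphere g x) = ∑ j, u j * e j x) (x y : S2) :
    ∑ i, e i (moveSphere g x) * conj (e i (moveSphere g y)) = ∑ i, e i x * conj (e i y) := by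
  choose u hu using hg
  let U : Matrix ι ι ℂ := Matrix.of u
  -- orthonormality of the family after the change of variables `g`
  have hU : U * U.conjTranspose = 1 := by
    ext i k
    have h1 := (measurePreserving_moveSphere g).integral_comp
      (sphereHomeomorph g).measurableEmbedding (fun x => e i x * conj (e k x))
    have h2 := he.integral_sum_mul_conj_sum (u i) (u k)
    simp only [← hu] at h2
    rw [Matrix.mul_apply, Matrix.one_apply, ← he i k, ← h1]
    exact h2.symm
  have hU' : U.conjTranspose * U = 1 := mul_eq_one_comm.1 hU
  have hU2 : ∀ j k, ∑ i, u i j * conj (u i k) = if j = k then 1 else 0 := by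
    intro j k
    have := congrFun (congrFun hU' k) j
    rw [Matrix.mul_apply, Matrix.one_apply] at this
    simpa [U, mul_comm, eq_comm] using this
  have h : ∀ i, e i (moveSphere g x) * conj (e i (moveSphere g y)) =
      ∑ j, ∑ k, (u i j * conj (u i k)) * (e j x * conj (e k y)) := by
    intro i
    rw [hu, hu, map_sum, Finset.sum_mul_sum]
    refine Finset.sum_congr rfl fun i _ => Finset.sum_congr rfl fun j _ => ?_
    rw [map_mul]
    ring
  simp only [h]
  rw [Finset.sum_comm]
  refine Finset.sum_congr rfl fun j _ => ?_
  rw [Finset.sum_comm]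
  simp only [← Finset.sum_mul, hU2]
  simp

end Family

lemma exists_orthonormal_of_finiteDimensional {H : Type*} [NormedAddCommGroup H]
    [InnerProductSpace ℂ H] (W : Submodule ℂ H) [FiniteDimensional ℂ W] :
    ∃ e : Fin (Module.finrank ℂ W) → H, Orthonormal ℂ e ∧ (∀ i, e i ∈ W) ∧
      ∀ w ∈ W, ∃ c : Fin (Module.finrank ℂ W) → ℂ, ∑ i, c i • e i = w := by
  refine ⟨fun i => (stdOrthonormalBasis ℂ W i : H), ?_, fun i => Subtype.property _, ?_⟩
  · exact (stdOrthonormalBasis ℂ W).orthonormal.comp_linearIsometry W.subtypeₗᵢ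
  · intro w hw
    refine ⟨fun i => (stdOrthonormalBasis ℂ W).repr ⟨w, hw⟩ i, ?_⟩
    simpa using congrArg Subtype.val ((stdOrthonormalBasis ℂ W).sum_repr ⟨w, hw⟩)

/-- The polynomials of degree at most `D`, restricted to the sphere, have an orthonormal basis of
at most `(D + 1)³` elements. -/
lemma exists_orthonormal_polyRestrict (D : ℕ) :
    ∃ n : ℕ, n ≤ (D + 1) ^ 3 ∧ ∃ f : Fin n → C(S2, ℂ), IsOrthonormalFamily f ∧
      (∀ i, ∃ p, p.totalDegree ≤ D ∧ f i = polyRestrict p) ∧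
      ∀ p, p.totalDegree ≤ D → ∃ c : Fin n → ℂ, ∀ x, polyRestrict p x = ∑ i, c i * f i x := by
  classical
  let R := MvPolynomial.restrictTotalDegree (Fin 3) ℂ D
  have hRle : R ≤ MvPolynomial.restrictDegree (Fin 3) ℂ D :=
    MvPolynomial.restrictTotalDegree_le_restrictDegree (Fin 3) ℂ D
  let S : Set (Fin 3 →₀ ℕ) := {n | ∀ i, n i ≤ D}
  let φ : S → (Fin 3 → Fin (D + 1)) := fun s i => ⟨s.1 i, Nat.lt_succ_of_le (s.2 i)⟩
  have hφ : Function.Injective φ := by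
    intro s t h
    ext i
    exact congrArg Fin.val (congrFun h i)
  have : Finite S := Finite.of_injective φ hφ
  have : Fintype S := Fintype.ofFinite S
  let B : Module.Basis S ℂ (MvPolynomial.restrictDegree (Fin 3) ℂ D) :=
    MvPolynomial.basisRestrictSupport ℂ S
  have : FiniteDimensional ℂ (MvPolynomial.restrictDegree (Fin 3) ℂ D) :=
    B.finiteDimensional_of_finite
  have hcard : Module.finrank ℂ (MvPolynomial.restrictDegree (Fin 3) ℂ D) ≤ (D + 1) ^ 3 := by
    rw [Module.finrank_eq_card_basis B]
    simpa using Fintype.card_le_of_injective φ hφ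
  have : FiniteDimensional ℂ R := Submodule.finiteDimensional_of_le hRle
  let Φ : MvPolynomial (Fin 3) ℂ →ₗ[ℂ] Lp ℂ 2 sigma :=
    (ContinuousMap.toLp 2 sigma ℂ : C(S2, ℂ) →L[ℂ] Lp ℂ 2 sigma).toLinearMap ∘ₗ polyRestrict
  let W := R.map Φ
  have hW : Module.finrank ℂ W ≤ (D + 1) ^ 3 :=
    (Submodule.finrank_map_le Φ R).trans ((Submodule.finrank_mono hRle).trans hcard)
  obtain ⟨e, he, heW, hspan⟩ := exists_orthonormal_of_finiteDimensional W
  have hmem : ∀ i, ∃ p ∈ R, Φ p = e i := fun i => Submodule.mem_map.1 (heW i)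
  choose p hpR hp using hmem
  refine ⟨_, hW, fun i => polyRestrict (p i), ?_, fun i =>
    ⟨p i, (MvPolynomial.mem_restrictTotalDegree _ _ _).1 (hpR i), rfl⟩, ?_⟩
  · intro i j
    have h1 := ContinuousMap.inner_toLp (𝕜 := ℂ) sigma (polyRestrict (p j)) (polyRestrict (p i))
    have h2 := orthonormal_iff_ite.1 he j i
    rw [← hp, ← hp] at h2
    rw [← h1]
    refine h2.trans ?_
    simp [eq_comm]
  · intro q hq
    have hqR : q ∈ R := (MvPolynomial.mem_restrictTotalDegree _ _ _).2 hq
    obtain ⟨c, hc⟩ := hspan (Φ q) (Submodule.mem_map_of_mem hqR)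
    have h2 : Φ (∑ i, c i • p i) = Φ q := by
      rw [map_sum, ← hc]
      refine Finset.sum_congr rfl fun i _ => ?_
      rw [map_smul, hp i]
    have h3 : polyRestrict (∑ i, c i • p i) = polyRestrict q :=
      ContinuousMap.toLp_injective sigma h2
    refine ⟨c, fun x => ?_⟩
    rw [← h3, map_sum, ContinuousMap.sum_apply]
    simp

/-- A Nikolskii inequality: on polynomials of degree at most `D`, the sup norm on the sphere is
controlled by the `L²` norm with a constant that is polynomial in `D`. The reproducing kernel is
constant on the diagonal by rotation invariance, and its integral over the diagonal is the
dimension of the space. -/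
lemma norm_polyRestrict_sq_mul_le {D : ℕ} {q : MvPolynomial (Fin 3) ℂ} (hq : q.totalDegree ≤ D)
    (x : S2) : ‖polyRestrict q x‖ ^ 2 * sigma.real Set.univ ≤
      (D + 1 : ℝ) ^ 3 * ∫ y, ‖polyRestrict q y‖ ^ 2 ∂sigma := by
  obtain ⟨n, hn, f, hf, hfp, hspan⟩ := exists_orthonormal_polyRestrict D
  have hinv : ∀ y, ∑ i, ‖f i y‖ ^ 2 = ∑ i, ‖f i x‖ ^ 2 := by
    intro y
    obtain ⟨g, -, rfl⟩ := exists_isRotation_moveSphere_eq x y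
    have := hf.kernel_moveSphere g (fun i => by
      obtain ⟨p, hp, hi⟩ := hfp i
      obtain ⟨c, hc⟩ := hspan (rotatePoly g p) ((totalDegree_rotatePoly_le g p).trans hp)
      refine ⟨c, fun y => ?_⟩
      rw [← hc, polyRestrict_rotatePoly, hi]) x x
    simp only [Complex.mul_conj'] at this
    exact_mod_cast this
  have hdiag : (∑ i, ‖f i x‖ ^ 2) * sigma.real Set.univ = n := by
    have h1 : ∫ y, ∑ i, ‖f i y‖ ^ 2 ∂sigma = (∑ i, ‖f i x‖ ^ 2) * sigma.real Set.univ := by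
      simp only [hinv, integral_const, smul_eq_mul, mul_comm]
    rw [← h1, integral_finsetSum _ fun i _ => integrable_of_continuous (by fun_prop)]
    have h2 : ∀ i, ∫ y, ‖f i y‖ ^ 2 ∂sigma = 1 := by
      intro i
      have := hf.integral_norm_sum_sq (Pi.single i 1)
      simpa [Pi.single_apply, apply_ite] using this
    simp [h2]
  obtain ⟨c, hc⟩ := hspan q hq
  have hnorm : ∫ y, ‖polyRestrict q y‖ ^ 2 ∂sigma = ∑ i, ‖c i‖ ^ 2 := by
    simp only [hc]
    exact hf.integral_norm_sum_sq c
  have hCS : ‖polyRestrict q x‖ ^ 2 ≤ (∑ i, ‖c i‖ ^ 2) * ∑ i, ‖f i x‖ ^ 2 := by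
    rw [hc]
    refine le_trans ?_ (Finset.sum_mul_sq_le_sq_mul_sq _ _ _)
    gcongr
    exact (norm_sum_le _ _).trans (by simp)
  have hn' : (n : ℝ) ≤ (D + 1 : ℝ) ^ 3 := by exact_mod_cast hn
  calc ‖polyRestrict q x‖ ^ 2 * sigma.real Set.univ
      ≤ ((∑ i, ‖c i‖ ^ 2) * ∑ i, ‖f i x‖ ^ 2) * sigma.real Set.univ := by gcongr
    _ = n * ∑ i, ‖c i‖ ^ 2 := by rw [mul_assoc, hdiag, mul_comm]
    _ ≤ _ := by rw [hnorm]; gcongr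

/-- The Nikolskii inequality between the sup norm and the `L^{2k}` norm, from the one for the
polynomial `q ^ k`. -/
lemma norm_polyRestrict_pow_mul_le {D : ℕ} {q : MvPolynomial (Fin 3) ℂ} (hq : q.totalDegree ≤ D)
    (k : ℕ) (x : S2) : ‖polyRestrict q x‖ ^ (2 * k) * sigma.real Set.univ ≤
      ((k * D : ℕ) + 1 : ℝ) ^ 3 * ∫ y, ‖polyRestrict q y‖ ^ (2 * k) ∂sigma := by
  have h := norm_polyRestrict_sq_mul_le (q := q ^ k) (D := k * D)
    ((MvPolynomial.totalDegree_pow q k).trans (Nat.mul_le_mul_left k hq)) x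
  have hp : ∀ y, ‖polyRestrict (q ^ k) y‖ ^ 2 = ‖polyRestrict q y‖ ^ (2 * k) := by
    intro y
    rw [polyRestrict_apply, map_pow, norm_pow, ← pow_mul, mul_comm k 2]
    rfl
  simpa only [hp] using h

/-- The real part of a polynomial function on the sphere is a polynomial function: conjugate the
coefficients. -/
lemma exists_polyRestrict_eq_re (q : MvPolynomial (Fin 3) ℂ) :
    ∃ r : MvPolynomial (Fin 3) ℂ, r.totalDegree ≤ q.totalDegree ∧
      ∀ x, polyRestrict r x = ((polyRestrict q x).re : ℂ) := by
  refine ⟨(1 / 2 : ℂ) • (q + MvPolynomial.map (starRingEnd ℂ) q), ?_, fun x => ?_⟩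
  · refine (MvPolynomial.totalDegree_smul_le _ _).trans
      ((MvPolynomial.totalDegree_add _ _).trans ?_)
    exact max_le le_rfl (MvPolynomial.totalDegree_le_of_support_subset
      (MvPolynomial.support_map_subset _ _))
  · have h : polyRestrict (MvPolynomial.map (starRingEnd ℂ) q) x = conj (polyRestrict q x) := by
      rw [polyRestrict_apply, polyRestrict_apply, ← MvPolynomial.eval₂_eq_eval_map,
        ← MvPolynomial.eval₂_id, MvPolynomial.eval₂_comp_left]
      simp [Function.comp_def]
    rw [map_smul, map_add, ContinuousMap.smul_apply, ContinuousMap.add_apply, h,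
      Complex.re_eq_add_conj]
    simp only [smul_eq_mul]
    ring

/-! ### Moments of integrals of a Gaussian process -/

lemma pow_le_factorial_mul_exp_add_exp (k : ℕ) (x : ℝ) :
    x ^ (2 * k) ≤ (2 * k).factorial * (Real.exp x + Real.exp (-x)) := by
  have h1 := Real.pow_div_factorial_le_exp (x := |x|) (abs_nonneg x) (2 * k)
  rw [div_le_iff₀ (by positivity), Even.pow_abs ⟨k, by ring⟩] at h1
  refine h1.trans ?_
  rw [mul_comm]
  gcongr
  rcases abs_cases x with ⟨h, -⟩ | ⟨h, -⟩ <;> rw [h] <;>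
    linarith [Real.exp_pos x, Real.exp_pos (-x)]

section Gaussian

variable {Ω : Type*} [MeasurableSpace Ω] {P : Measure Ω}

/-- A bound on the even moments of a centred Gaussian variable, from its moment generating
function at `t = √(2k / E Z²)`. -/
lemma integral_pow_le_of_hasGaussianLaw [IsProbabilityMeasure P] {Z : Ω → ℝ}
    (hZ : HasGaussianLaw Z P) (h0 : ∫ ω, Z ω ∂P = 0) {k : ℕ} (hk : 1 ≤ k) :
    ∫ ω, Z ω ^ (2 * k) ∂P ≤ (12 * k : ℝ) ^ k * (∫ ω, Z ω ^ 2 ∂P) ^ k := by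
  have hvar : Var[Z; P] = ∫ ω, Z ω ^ 2 ∂P :=
    variance_of_integral_eq_zero hZ.aemeasurable h0
  have hmap := hZ.map_eq_gaussianReal
  rw [h0, hvar] at hmap
  set s := ∫ ω, Z ω ^ 2 ∂P with hs
  have hs0 : 0 ≤ s := integral_nonneg fun ω => sq_nonneg _
  have hint : Integrable (fun ω => Z ω ^ 2) P := hZ.memLp_two.integrable_sq
  rcases hs0.eq_or_lt with h | hpos
  · have hz : ∀ᵐ ω ∂P, Z ω = 0 := by
      have := (integral_eq_zero_iff_of_nonneg (fun ω => sq_nonneg (Z ω)) hint).1 h.symm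
      filter_upwards [this] with ω hω
      simpa using hω
    rw [integral_congr_ae (g := fun _ => (0 : ℝ))]
    · simp only [integral_zero]; positivity
    · filter_upwards [hz] with ω hω
      rw [hω, zero_pow (by omega)]
  set t := √(2 * k / s) with ht
  have hk0 : (0 : ℝ) < k := by exact_mod_cast hk
  have ht2 : t ^ 2 = 2 * k / s := Real.sq_sqrt (by positivity)
  have hexp : ∀ r : ℝ, Integrable (fun ω => Real.exp (r * Z ω)) P := by
    intro r
    rw [← mgf_pos_iff, mgf_gaussianReal hmap]
    positivity
  have hm : ∀ r : ℝ, ∫ ω, Real.exp (r * Z ω) ∂P = Real.exp (s * r ^ 2 / 2) := by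
    intro r
    have := mgf_gaussianReal hmap r
    rw [mgf] at this
    rw [this, Real.coe_toNNReal _ hs0]
    simp
  have key : ∫ ω, (t * Z ω) ^ (2 * k) ∂P ≤
      ∫ ω, ((2 * k).factorial : ℝ) * (Real.exp (t * Z ω) + Real.exp (-t * Z ω)) ∂P := by
    refine integral_mono_of_nonneg (ae_of_all _ fun ω => ?_)
      (((hexp t).add (hexp (-t))).const_mul _) (ae_of_all _ fun ω => ?_)
    · exact Even.pow_nonneg ⟨k, by ring⟩ _
    · simpa using pow_le_factorial_mul_exp_add_exp k (t * Z ω)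
  rw [integral_const_mul, integral_add (hexp t) (hexp (-t)), hm, hm, neg_sq, ht2] at key
  simp only [mul_pow, integral_const_mul] at key
  rw [pow_mul, ht2, show s * (2 * k / s) / 2 = (k : ℝ) by field_simp] at key
  have hfac : ((2 * k).factorial : ℝ) ≤ (2 * k : ℝ) ^ (2 * k) := by
    exact_mod_cast Nat.factorial_le_pow (2 * k)
  have he : Real.exp k ≤ 3 ^ k := by
    rw [← Real.exp_one_pow]
    gcongr
    exact Real.exp_one_lt_d9.le.trans (by norm_num)
  have h2 : (2 : ℝ) ≤ 2 ^ k := by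
    calc (2 : ℝ) = 2 ^ 1 := by norm_num
      _ ≤ 2 ^ k := pow_le_pow_right₀ (by norm_num) hk
  have h3 : (2 * k / s : ℝ) ^ k * ∫ ω, Z ω ^ (2 * k) ∂P ≤
      (2 * k / s : ℝ) ^ k * ((12 * k : ℝ) ^ k * s ^ k) := by
    refine key.trans ?_
    calc ((2 * k).factorial : ℝ) * (Real.exp k + Real.exp k)
        = ((2 * k).factorial : ℝ) * (2 * Real.exp k) := by ring
      _ ≤ (2 * k : ℝ) ^ (2 * k) * (2 ^ k * 3 ^ k) := by gcongr
      _ = _ := by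
        rw [← mul_pow, ← mul_pow, ← mul_pow, pow_mul, ← mul_pow]
        congr 1
        field_simp
        ring
  exact le_of_mul_le_mul_left h3 (by positivity)

/-- The bound on the `2k`-th moment in terms of the second moment passes to limits in `L²`, by
Fatou's lemma along an almost surely convergent subsequence. -/
lemma isClosed_setOf_lintegral_pow_le (A : ℝ) (k : ℕ) :
    IsClosed {f : Lp ℝ 2 P | ∫⁻ ω, ‖f ω‖ₑ ^ (2 * k) ∂P ≤ ENNReal.ofReal (A * ‖f‖ ^ (2 * k))} := by
  refine IsSeqClosed.isClosed fun u f hu hlim => ?_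
  have hmeas := tendstoInMeasure_of_tendsto_Lp hlim
  obtain ⟨ns, hns, hae⟩ := hmeas.exists_seq_tendsto_ae
  have hRHS : Tendsto (fun i => ENNReal.ofReal (A * ‖u (ns i)‖ ^ (2 * k))) atTop
      (nhds (ENNReal.ofReal (A * ‖f‖ ^ (2 * k)))) :=
    ENNReal.tendsto_ofReal ((((hlim.comp hns.tendsto_atTop).norm).pow _).const_mul _)
  calc ∫⁻ ω, ‖f ω‖ₑ ^ (2 * k) ∂P
      = ∫⁻ ω, liminf (fun i => ‖u (ns i) ω‖ₑ ^ (2 * k)) atTop ∂P := by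
        refine lintegral_congr_ae ?_
        filter_upwards [hae] with ω hω
        exact (((ENNReal.continuous_pow _).tendsto _).comp hω.enorm).liminf_eq.symm
    _ ≤ liminf (fun i => ∫⁻ ω, ‖u (ns i) ω‖ₑ ^ (2 * k) ∂P) atTop :=
        lintegral_liminf_le' fun i => (Lp.aestronglyMeasurable _).enorm.pow_const _
    _ ≤ liminf (fun i => ENNReal.ofReal (A * ‖u (ns i)‖ ^ (2 * k))) atTop :=
        liminf_le_liminf (Eventually.of_forall fun i => hu (ns i))
    _ = _ := hRHS.liminf_eq

/-- A jointly measurable centred Gaussian process, with the same variance `v` at all points. -/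
structure IsCenteredGaussian {α : Type*} [MeasurableSpace α] (T : α → Ω → ℝ) (P : Measure Ω)
    (v : ℝ) : Prop where
  measurable : Measurable (Function.uncurry T)
  gaussian : IsGaussianProcess T P
  mean_zero : ∀ x, ∫ ω, T x ω ∂P = 0
  variance : ∀ x, ∫ ω, T x ω ^ 2 ∂P = v

section Integral

variable {α : Type*} [MeasurableSpace α] {μ : Measure α} [IsFiniteMeasure μ]
  {T : α → Ω → ℝ} {v : ℝ} {h : α → ℝ} {H : ℝ}

lemma IsCenteredGaussian.memLp (hT : IsCenteredGaussian T P v) (x : α) : MemLp (T x) 2 P :=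
  (hT.gaussian.hasGaussianLaw_eval x).memLp_two

lemma integral_norm_mul_le {X Z : Ω → ℝ} (hX : MemLp X 2 P) (hZ : MemLp Z 2 P) :
    ∫ ω, ‖X ω * Z ω‖ ∂P ≤ ∫ ω, X ω ^ 2 ∂P + ∫ ω, Z ω ^ 2 ∂P := by
  rw [← integral_add hX.integrable_sq hZ.integrable_sq]
  refine integral_mono (hX.integrable_mul hZ).norm (hX.integrable_sq.add hZ.integrable_sq)
    fun ω => ?_
  rw [Real.norm_eq_abs, abs_mul, ← sq_abs (X ω), ← sq_abs (Z ω)]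
  nlinarith [sq_nonneg (|X ω| - |Z ω|), sq_nonneg (|X ω|), sq_nonneg (|Z ω|)]

lemma IsCenteredGaussian.measurable_mul (hT : IsCenteredGaussian T P v) (hh : Measurable h) :
    Measurable fun q : Ω × α => h q.2 * T q.2 q.1 :=
  (hh.comp measurable_snd).mul (hT.measurable.comp measurable_swap)

lemma IsCenteredGaussian.integrable_prod [IsProbabilityMeasure P]
    (hT : IsCenteredGaussian T P v) (hh : Measurable h) (hH : ∀ x, |h x| ≤ H) :
    Integrable (fun q : Ω × (α × α) => (h q.2.1 * T q.2.1 q.1) * (h q.2.2 * T q.2.2 q.1))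
      (P.prod (μ.prod μ)) := by
  have hm := hT.measurable_mul hh
  have hmeas : Measurable fun q : Ω × (α × α) =>
      (h q.2.1 * T q.2.1 q.1) * (h q.2.2 * T q.2.2 q.1) :=
    (hm.comp (measurable_fst.prodMk (measurable_fst.comp measurable_snd))).mul
      (hm.comp (measurable_fst.prodMk (measurable_snd.comp measurable_snd)))
  have hL : ∀ x, MemLp (fun ω => h x * T x ω) 2 P := fun x => (hT.memLp x).const_mul _
  have hv : ∀ x, ∫ ω, (h x * T x ω) ^ 2 ∂P ≤ H ^ 2 * v := by
    intro x
    simp only [mul_pow, integral_const_mul, hT.variance]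
    have : 0 ≤ v := by rw [← hT.variance x]; exact integral_nonneg fun ω => sq_nonneg _
    have h2 : h x ^ 2 ≤ H ^ 2 := by
      rw [← sq_abs]
      exact pow_le_pow_left₀ (abs_nonneg _) (hH x) 2
    gcongr
  rw [integrable_prod_iff' hmeas.aestronglyMeasurable]
  refine ⟨ae_of_all _ fun y => (hL y.1).integrable_mul (hL y.2), ?_⟩
  refine Integrable.of_bound (C := H ^ 2 * v + H ^ 2 * v) ?_ (ae_of_all _ fun y => ?_)
  · exact (hmeas.norm.stronglyMeasurable.integral_prod_left').aestronglyMeasurable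
  · rw [Real.norm_of_nonneg (integral_nonneg fun ω => norm_nonneg _)]
    exact (integral_norm_mul_le (hL y.1) (hL y.2)).trans (add_le_add (hv _) (hv _))

lemma sq_integral_eq_integral_prod {Ω : Type*} {T : α → Ω → ℝ} (ω : Ω) :
    (∫ x, h x * T x ω ∂μ) ^ 2 =
      ∫ q : α × α, (h q.1 * T q.1 ω) * (h q.2 * T q.2 ω) ∂(μ.prod μ) := by
  rw [sq, ← integral_prod_mul]

lemma IsCenteredGaussian.memLp_integral [IsProbabilityMeasure P]
    (hT : IsCenteredGaussian T P v) (hh : Measurable h) (hH : ∀ x, |h x| ≤ H) :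
    MemLp (fun ω => ∫ x, h x * T x ω ∂μ) 2 P := by
  rw [memLp_two_iff_integrable_sq]
  · simp only [sq_integral_eq_integral_prod]
    exact (hT.integrable_prod (μ := μ) hh hH).integral_prod_left
  · exact ((hT.measurable_mul hh).stronglyMeasurable.integral_prod_right').aestronglyMeasurable

lemma IsCenteredGaussian.integral_integral_sq [IsProbabilityMeasure P]
    (hT : IsCenteredGaussian T P v) (hh : Measurable h) (hH : ∀ x, |h x| ≤ H) :
    ∫ ω, (∫ x, h x * T x ω ∂μ) ^ 2 ∂P =
      ∫ q : α × α, h q.1 * h q.2 * ∫ ω, T q.1 ω * T q.2 ω ∂P ∂(μ.prod μ) := by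
  simp only [sq_integral_eq_integral_prod]
  rw [integral_integral_swap (hT.integrable_prod hh hH)]
  refine integral_congr_ae (ae_of_all _ fun q => ?_)
  simp only
  rw [← integral_const_mul]
  refine integral_congr_ae (ae_of_all _ fun ω => ?_)
  simp only
  ring

/-- The integral of the process against a bounded weight lies in the closed linear span of the
process in `L²(P)`: it is orthogonal to everything that is orthogonal to the process. -/
lemma IsCenteredGaussian.integral_mem_closure [IsProbabilityMeasure P]
    (hT : IsCenteredGaussian T P v) (hh : Measurable h) (hH : ∀ x, |h x| ≤ H) :
    (hT.memLp_integral (μ := μ) hh hH).toLp ∈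
      (Submodule.span ℝ (Set.range fun x => (hT.memLp x).toLp)).topologicalClosure := by
  rw [← Submodule.orthogonal_orthogonal_eq_closure, Submodule.mem_orthogonal]
  intro Z hZ
  have hZ0 : ∀ x, ∫ ω, Z ω * T x ω ∂P = 0 := by
    intro x
    have h1 := Submodule.inner_left_of_mem_orthogonal
      (Submodule.subset_span (Set.mem_range_self x)) hZ
    rw [L2.inner_def] at h1
    rw [← h1]
    refine integral_congr_ae ?_
    filter_upwards [(hT.memLp x).coeFn_toLp] with ω hω
    simp [hω, mul_comm]
  have hmeas : Measurable fun q : Ω × α => Z q.1 * (h q.2 * T q.2 q.1) :=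
    ((Lp.stronglyMeasurable Z).measurable.comp measurable_fst).mul (hT.measurable_mul hh)
  have hint : Integrable (fun q : Ω × α => Z q.1 * (h q.2 * T q.2 q.1)) (P.prod μ) := by
    have hL : ∀ x, MemLp (fun ω => h x * T x ω) 2 P := fun x => (hT.memLp x).const_mul _
    rw [integrable_prod_iff' hmeas.aestronglyMeasurable]
    refine ⟨ae_of_all _ fun y => (Lp.memLp Z).integrable_mul (hL y), ?_⟩
    refine Integrable.of_bound (C := ∫ ω, Z ω ^ 2 ∂P + H ^ 2 * v) ?_ (ae_of_all _ fun x => ?_)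
    · exact (hmeas.norm.stronglyMeasurable.integral_prod_left').aestronglyMeasurable
    · rw [Real.norm_of_nonneg (integral_nonneg fun ω => norm_nonneg _)]
      refine (integral_norm_mul_le (Lp.memLp Z) (hL x)).trans (add_le_add le_rfl ?_)
      simp only [mul_pow, integral_const_mul, hT.variance]
      have : 0 ≤ v := by rw [← hT.variance x]; exact integral_nonneg fun ω => sq_nonneg _
      have h2 : h x ^ 2 ≤ H ^ 2 := by
        rw [← sq_abs]
        exact pow_le_pow_left₀ (abs_nonneg _) (hH x) 2
      gcongr
  rw [L2.inner_def]
  calc _ = ∫ ω, ∫ x, Z ω * (h x * T x ω) ∂μ ∂P := by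
        refine integral_congr_ae ?_
        filter_upwards [(hT.memLp_integral (μ := μ) hh hH).coeFn_toLp] with ω hω
        rw [hω, integral_const_mul]
        simp [mul_comm]
    _ = ∫ x, ∫ ω, Z ω * (h x * T x ω) ∂P ∂μ := integral_integral_swap hint
    _ = 0 := by
        have : ∀ x, ∫ ω, Z ω * (h x * T x ω) ∂P = 0 := by
          intro x
          simp only [mul_left_comm _ (h x), integral_const_mul, hZ0, mul_zero]
        simp [this]

lemma norm_toLp_pow {X : Ω → ℝ} (hX : MemLp X 2 P) (k : ℕ) :
    ‖hX.toLp‖ ^ (2 * k) = (∫ ω, X ω ^ 2 ∂P) ^ k := by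
  rw [pow_mul, ← real_inner_self_eq_norm_sq, L2.inner_def]
  congr 1
  refine integral_congr_ae ?_
  filter_upwards [hX.coeFn_toLp] with ω hω
  simp [hω, sq]

lemma enorm_pow_two_mul (x : ℝ) (k : ℕ) : ‖x‖ₑ ^ (2 * k) = ENNReal.ofReal (x ^ (2 * k)) := by
  rw [← ofReal_norm, ← ENNReal.ofReal_pow (norm_nonneg _), Real.norm_eq_abs,
    Even.pow_abs ⟨k, two_mul k⟩]

lemma lintegral_pow_le_of_hasGaussianLaw [IsProbabilityMeasure P] {Z : Ω → ℝ}
    (hZ : HasGaussianLaw Z P) (h0 : ∫ ω, Z ω ∂P = 0) {k : ℕ} (hk : 1 ≤ k) :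
    ∫⁻ ω, ‖Z ω‖ₑ ^ (2 * k) ∂P ≤
      ENNReal.ofReal ((12 * k : ℝ) ^ k * (∫ ω, Z ω ^ 2 ∂P) ^ k) := by
  have hpow : Integrable (fun ω => Z ω ^ (2 * k)) P := by
    have h5 := (hZ.memLp (p := (2 * k : ℕ)) (ENNReal.natCast_ne_top _)).integrable_norm_pow
      (by omega)
    simpa [Even.pow_abs ⟨k, two_mul k⟩] using h5
  simp only [enorm_pow_two_mul]
  rw [← ofReal_integral_eq_lintegral_ofReal hpow
    (ae_of_all _ fun ω => Even.pow_nonneg ⟨k, two_mul k⟩ _)]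
  exact ENNReal.ofReal_le_ofReal (integral_pow_le_of_hasGaussianLaw hZ h0 hk)

lemma coeFn_sum_smul_toLp (hT : IsCenteredGaussian T P v) (c : α → ℝ) (s : Finset α) :
    (∑ x ∈ s, c x • (hT.memLp x).toLp : Lp ℝ 2 P) =ᵐ[P] fun ω => ∑ x ∈ s, c x * T x ω := by
  refine (Lp.coeFn_fun_finsetSum _ _).trans ?_
  have h2 : ∀ᵐ ω ∂P, ∀ x ∈ s, (c x • (hT.memLp x).toLp : Lp ℝ 2 P) ω = c x * T x ω := by
    rw [eventually_all_finset]
    intro x _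
    filter_upwards [Lp.coeFn_smul (c x) (hT.memLp x).toLp, (hT.memLp x).coeFn_toLp] with ω h3 h4
    rw [h3, Pi.smul_apply, h4, smul_eq_mul]
  filter_upwards [h2] with ω hω
  exact Finset.sum_congr rfl hω

lemma IsCenteredGaussian.lintegral_pow_le_of_mem_span [IsProbabilityMeasure P]
    (hT : IsCenteredGaussian T P v) {k : ℕ} (hk : 1 ≤ k) {f : Lp ℝ 2 P}
    (hf : f ∈ Submodule.span ℝ (Set.range fun x => (hT.memLp x).toLp)) :
    ∫⁻ ω, ‖f ω‖ₑ ^ (2 * k) ∂P ≤ ENNReal.ofReal ((12 * k : ℝ) ^ k * ‖f‖ ^ (2 * k)) := by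
  obtain ⟨c, rfl⟩ := Finsupp.mem_span_range_iff_exists_finsupp.1 hf
  have hZG : HasGaussianLaw (fun ω => ∑ x ∈ c.support, c x * T x ω) P :=
    (hT.gaussian.smul (fun x => c x)).hasGaussianLaw_fun_sum (I := c.support)
  have hZ0 : ∫ ω, ∑ x ∈ c.support, c x * T x ω ∂P = 0 := by
    rw [integral_finsetSum _ fun x _ => ((hT.memLp x).integrable one_le_two).const_mul _]
    simp [integral_const_mul, hT.mean_zero]
  have hae := coeFn_sum_smul_toLp hT c c.support
  have hf : (c.sum fun x a => a • (hT.memLp x).toLp) = hZG.memLp_two.toLp := by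
    ext1
    exact hae.trans hZG.memLp_two.coeFn_toLp.symm
  rw [hf, norm_toLp_pow]
  refine le_trans (le_of_eq (lintegral_congr_ae ?_)) (lintegral_pow_le_of_hasGaussianLaw hZG hZ0 hk)
  filter_upwards [hZG.memLp_two.coeFn_toLp] with ω hω
  rw [hω]

/-- The even moments of `∫ h T` are bounded as those of a Gaussian variable. -/
lemma IsCenteredGaussian.lintegral_integral_pow_le [IsProbabilityMeasure P]
    (hT : IsCenteredGaussian T P v) (hh : Measurable h) (hH : ∀ x, |h x| ≤ H) {k : ℕ}
    (hk : 1 ≤ k) :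
    ∫⁻ ω, ‖∫ x, h x * T x ω ∂μ‖ₑ ^ (2 * k) ∂P ≤
      ENNReal.ofReal ((12 * k : ℝ) ^ k * (∫ ω, (∫ x, h x * T x ω ∂μ) ^ 2 ∂P) ^ k) := by
  have hmem : ∫⁻ ω, ‖((hT.memLp_integral (μ := μ) hh hH).toLp : Lp ℝ 2 P) ω‖ₑ ^ (2 * k) ∂P ≤
      ENNReal.ofReal ((12 * k : ℝ) ^ k * ‖(hT.memLp_integral (μ := μ) hh hH).toLp‖ ^ (2 * k)) :=
    closure_minimal (t := {f : Lp ℝ 2 P | ∫⁻ ω, ‖f ω‖ₑ ^ (2 * k) ∂P ≤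
      ENNReal.ofReal ((12 * k : ℝ) ^ k * ‖f‖ ^ (2 * k))})
      (fun f hf => hT.lintegral_pow_le_of_mem_span hk hf)
      (isClosed_setOf_lintegral_pow_le ((12 * k : ℝ) ^ k) k)
      (hT.integral_mem_closure (μ := μ) hh hH)
  rw [norm_toLp_pow] at hmem
  refine le_trans (le_of_eq (lintegral_congr_ae ?_)) hmem
  filter_upwards [(hT.memLp_integral (μ := μ) hh hH).coeFn_toLp] with ω hω
  rw [hω]

end Integral

end Gaussian

/-! ### The rotation-invariant kernel of the needlet field -/

section Basis

variable {Y : ℕ → ℤ → S2 → ℂ}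

lemma IsSphericalHarmonicBasis.exists_polyRestrict (hY : IsSphericalHarmonicBasis Y) :
    ∃ Q : ℕ → ℤ → MvPolynomial (Fin 3) ℂ, ∀ l : ℕ, ∀ m ∈ Finset.Icc (-(l : ℤ)) l,
      (Q l m).totalDegree ≤ l ∧ Y l m = polyRestrict (Q l m) := by
  have h : ∀ (l : ℕ) (m : ℤ), ∃ p : MvPolynomial (Fin 3) ℂ, m ∈ Finset.Icc (-(l : ℤ)) l →
      p.totalDegree ≤ l ∧ Y l m = polyRestrict p := by
    intro l m
    by_cases hm : m ∈ Finset.Icc (-(l : ℤ)) l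
    · obtain ⟨p, hp, -, hf⟩ := hY.harmonic l m hm
      exact ⟨p, fun _ => ⟨hp.totalDegree_le, funext hf⟩⟩
    · exact ⟨0, fun h => absurd h hm⟩
  choose Q hQ using h
  exact ⟨Q, hQ⟩

lemma IsSphericalHarmonicBasis.continuous (hY : IsSphericalHarmonicBasis Y) {l : ℕ} {m : ℤ}
    (hm : m ∈ Finset.Icc (-(l : ℤ)) l) : Continuous (Y l m) := by
  obtain ⟨Q, hQ⟩ := hY.exists_polyRestrict
  rw [(hQ l m hm).2]
  exact (polyRestrict (Q l m)).continuous

/-- The reproducing kernel of the harmonics of degree `l` is rotation invariant, because the space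
of these harmonics is. -/
lemma IsSphericalHarmonicBasis.kernel_moveSphere (hY : IsSphericalHarmonicBasis Y) (l : ℕ)
    (g : E3 ≃ₗᵢ[ℝ] E3) (x y : S2) :
    ∑ m ∈ Finset.Icc (-(l : ℤ)) l, Y l m (moveSphere g x) * conj (Y l m (moveSphere g y)) =
      ∑ m ∈ Finset.Icc (-(l : ℤ)) l, Y l m x * conj (Y l m y) := by
  let e : Finset.Icc (-(l : ℤ)) l → C(S2, ℂ) := fun m => ⟨Y l m, hY.continuous m.2⟩
  have he : IsOrthonormalFamily e := by
    intro i j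
    refine (hY.orthonormal l i i.2 l j j.2).trans ?_
    simp only [true_and, Subtype.coe_inj]
  have h := he.kernel_moveSphere g (fun i => by
    obtain ⟨a, ha⟩ := hY.spanning l _ ((hY.harmonic l i i.2).comp_moveSphere g)
    refine ⟨fun m => a m, fun x => ?_⟩
    refine (ha x).trans ?_
    exact (Finset.sum_coe_sort (Finset.Icc (-(l : ℤ)) l) fun m => a m * Y l m x).symm) x y
  rw [← Finset.sum_coe_sort, ← Finset.sum_coe_sort (Finset.Icc (-(l : ℤ)) l)]
  exact h

/-- The kernel that represents the needlet field as an integral of `T`. The real part is taken to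
match `needletField`. -/
def needletKernel (b : ℝ → ℝ) (Y : ℕ → ℤ → S2 → ℂ) (j : ℕ) (x y : S2) : ℝ :=
  (∑ l ∈ Finset.Icc ((2 : ℕ) ^ (j - 1)) (2 ^ (j + 1)),
    (b ((l : ℝ) / 2 ^ j) : ℂ) * ∑ m ∈ Finset.Icc (-(l : ℤ)) l, Y l m x * conj (Y l m y)).re

lemma IsSphericalHarmonicBasis.needletKernel_moveSphere (hY : IsSphericalHarmonicBasis Y)
    (b : ℝ → ℝ) (j : ℕ) (g : E3 ≃ₗᵢ[ℝ] E3) (x y : S2) :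
    needletKernel b Y j (moveSphere g x) (moveSphere g y) = needletKernel b Y j x y := by
  simp only [needletKernel, hY.kernel_moveSphere]

lemma IsSphericalHarmonicBasis.continuous_needletKernel (hY : IsSphericalHarmonicBasis Y)
    (b : ℝ → ℝ) (j : ℕ) (x : S2) : Continuous (needletKernel b Y j x) := by
  refine Complex.continuous_re.comp (continuous_finsetSum _ fun l _ => continuous_const.mul ?_)
  refine continuous_finsetSum _ fun m hm => continuous_const.mul ?_
  exact Complex.continuous_conj.comp (hY.continuous hm)

lemma exists_abs_le_of_continuous {h : S2 → ℝ} (hh : Continuous h) : ∃ H, ∀ x, |h x| ≤ H := by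
  obtain ⟨x₀, -, hx₀⟩ := isCompact_univ.exists_isMaxOn Set.univ_nonempty hh.abs.continuousOn
  exact ⟨|h x₀|, fun x => hx₀ (Set.mem_univ x)⟩

/-- For a trajectory that is not integrable the coefficients are junk values, and the identity may
fail. -/
lemma IsSphericalHarmonicBasis.needletField_eq_integral {Ω : Type*}
    (hY : IsSphericalHarmonicBasis Y) (b : ℝ → ℝ) (j : ℕ) {T : S2 → Ω → ℝ} {ω : Ω}
    (hω : Integrable (fun y => T y ω) sigma) (x : S2) :
    needletField b T Y j x ω = ∫ y, needletKernel b Y j x y * T y ω ∂sigma := by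
  have hint : ∀ l : ℕ, ∀ m ∈ Finset.Icc (-(l : ℤ)) l, Integrable
      (fun y => (b ((l : ℝ) / 2 ^ j) : ℂ) * ((T y ω : ℂ) * conj (Y l m y)) * Y l m x) sigma := by
    intro l m hm
    obtain ⟨y₀, -, hy₀⟩ := isCompact_univ.exists_isMaxOn Set.univ_nonempty
      (hY.continuous hm).norm.continuousOn
    refine ((hω.ofReal.mul_bdd (c := ‖Y l m y₀‖) ?_ ?_).const_mul _).mul_const _
    · exact (Complex.continuous_conj.comp (hY.continuous hm)).aestronglyMeasurable
    · exact ae_of_all _ fun y => by simpa using hy₀ (Set.mem_univ y)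
  have hint' : ∀ l : ℕ, Integrable (fun y => ∑ m ∈ Finset.Icc (-(l : ℤ)) l,
      (b ((l : ℝ) / 2 ^ j) : ℂ) * ((T y ω : ℂ) * conj (Y l m y)) * Y l m x) sigma :=
    fun l => integrable_finsetSum _ (hint l)
  have h1 : ∑ l ∈ Finset.Icc ((2 : ℕ) ^ (j - 1)) (2 ^ (j + 1)), ∑ m ∈ Finset.Icc (-(l : ℤ)) l,
      (b ((l : ℝ) / 2 ^ j) : ℂ) * coeff T Y l m ω * Y l m x =
      ∫ y, ∑ l ∈ Finset.Icc ((2 : ℕ) ^ (j - 1)) (2 ^ (j + 1)), ∑ m ∈ Finset.Icc (-(l : ℤ)) l,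
        (b ((l : ℝ) / 2 ^ j) : ℂ) * ((T y ω : ℂ) * conj (Y l m y)) * Y l m x ∂sigma := by
    rw [integral_finsetSum _ fun l _ => hint' l]
    refine Finset.sum_congr rfl fun l _ => ?_
    rw [integral_finsetSum _ (hint l)]
    refine Finset.sum_congr rfl fun m _ => ?_
    rw [integral_mul_const, integral_const_mul, coeff]
  rw [needletField, h1]
  refine (integral_re (integrable_finsetSum _ fun l _ => hint' l)).symm.trans ?_
  refine integral_congr_ae (ae_of_all _ fun y => ?_)
  simp only [needletKernel]
  rw [mul_comm, ← Complex.re_ofReal_mul, Finset.mul_sum]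
  refine congrArg Complex.re (Finset.sum_congr rfl fun l _ => ?_)
  rw [Finset.mul_sum, Finset.mul_sum]
  refine Finset.sum_congr rfl fun m _ => ?_
  ring

end Basis

/-! ### The variance of the needlet field -/

section Field

variable {Ω : Type*} [MeasurableSpace Ω] {P : Measure Ω} {T : S2 → Ω → ℝ} {Y : ℕ → ℤ → S2 → ℂ}

lemma IsIsotropicGaussianField.integral_mul_moveSphere (hT : IsIsotropicGaussianField T P)
    {g : E3 ≃ₗᵢ[ℝ] E3} (hg : IsRotation g) (x y : S2) :
    ∫ ω, T (moveSphere g x) ω * T (moveSphere g y) ω ∂P = ∫ ω, T x ω * T y ω ∂P := by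
  have hm : ∀ x, Measurable (T x) := fun x => hT.measurable.comp measurable_prodMk_left
  have hmeas : ∀ z : Fin 2 → S2, Measurable fun ω i => T (z i) ω :=
    fun z => measurable_pi_lambda _ fun i => hm (z i)
  have hF : Measurable fun u : Fin 2 → ℝ => u 0 * u 1 := by fun_prop
  have h := congrArg (fun ν => ∫ u : Fin 2 → ℝ, u 0 * u 1 ∂ν) (hT.isotropic g hg 2 ![x, y])
  rw [integral_map (hmeas fun i => moveSphere g (![x, y] i)).aemeasurable
    hF.aestronglyMeasurable, integral_map (hmeas _).aemeasurable hF.aestronglyMeasurable] at h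
  simpa using h

lemma IsIsotropicGaussianField.exists_isStationaryGaussian (hT : IsIsotropicGaussianField T P) :
    ∃ v, IsCenteredGaussian T P v := by
  obtain ⟨x₀⟩ := (inferInstance : Nonempty S2)
  refine ⟨∫ ω, T x₀ ω ^ 2 ∂P, hT.measurable, hT.gaussian, hT.mean_zero, fun x => ?_⟩
  obtain ⟨g, hg, rfl⟩ := exists_isRotation_moveSphere_eq x₀ x
  simp only [sq]
  exact hT.integral_mul_moveSphere hg x₀ x₀

lemma IsIsotropicGaussianField.measurable_coeff (hT : IsIsotropicGaussianField T P)
    (hY : IsSphericalHarmonicBasis Y) {l : ℕ} {m : ℤ} (hm : m ∈ Finset.Icc (-(l : ℤ)) l) :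
    Measurable (coeff T Y l m) := by
  have h : Measurable fun q : Ω × S2 => (T q.2 q.1 : ℂ) * conj (Y l m q.2) :=
    (Complex.measurable_ofReal.comp (hT.measurable.comp measurable_swap)).mul
      ((Complex.continuous_conj.comp (hY.continuous hm)).measurable.comp measurable_snd)
  exact h.stronglyMeasurable.integral_prod_right'.measurable

lemma IsIsotropicGaussianField.measurable_needletField (hT : IsIsotropicGaussianField T P)
    (hY : IsSphericalHarmonicBasis Y) (b : ℝ → ℝ) (j : ℕ) :
    Measurable fun q : S2 × Ω => needletField b T Y j q.1 q.2 := by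
  refine Complex.measurable_re.comp (Finset.measurable_sum _ fun l _ =>
    Finset.measurable_sum _ fun m hm => ?_)
  exact (measurable_const.mul ((hT.measurable_coeff hY hm).comp measurable_snd)).mul
    ((hY.continuous hm).measurable.comp measurable_fst)

variable [IsProbabilityMeasure P]

/-- By Fubini's theorem, almost every trajectory is square integrable on the sphere. -/
lemma IsIsotropicGaussianField.ae_integrable (hT : IsIsotropicGaussianField T P) :
    ∀ᵐ ω ∂P, Integrable (fun y => T y ω) sigma := by
  obtain ⟨v, hS⟩ := hT.exists_isStationaryGaussian
  have hint : Integrable (fun q : S2 × Ω => T q.1 q.2 ^ 2) (sigma.prod P) := by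
    have hm : Measurable fun q : S2 × Ω => T q.1 q.2 ^ 2 := hT.measurable.pow_const 2
    rw [integrable_prod_iff hm.aestronglyMeasurable]
    refine ⟨ae_of_all _ fun x => (hS.memLp x).integrable_sq, ?_⟩
    simp [hS.variance]
  filter_upwards [hint.prod_left_ae] with ω hω
  have hm : Measurable fun y => T y ω := hT.measurable.comp measurable_prodMk_right
  exact ((memLp_two_iff_integrable_sq hm.aestronglyMeasurable).2 hω).integrable one_le_two

lemma IsIsotropicGaussianField.integrable_norm_coeff_sq (hT : IsIsotropicGaussianField T P)
    (hY : IsSphericalHarmonicBasis Y) {l : ℕ} {m : ℤ} (hm : m ∈ Finset.Icc (-(l : ℤ)) l) :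
    Integrable (fun ω => ‖coeff T Y l m ω‖ ^ 2) P := by
  obtain ⟨v, hS⟩ := hT.exists_isStationaryGaussian
  have hc := Complex.continuous_conj.comp (hY.continuous hm)
  have hre := Complex.continuous_re.comp hc
  have him := Complex.continuous_im.comp hc
  obtain ⟨H, hH⟩ := exists_abs_le_of_continuous hre
  obtain ⟨H', hH'⟩ := exists_abs_le_of_continuous him
  have h1 := (hS.memLp_integral (μ := sigma) hre.measurable hH).integrable_sq.add
    (hS.memLp_integral (μ := sigma) him.measurable hH').integrable_sq
  refine h1.congr ?_
  filter_upwards [hT.ae_integrable] with ω hω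
  have hint : Integrable (fun y => (T y ω : ℂ) * conj (Y l m y)) sigma := by
    obtain ⟨y₀, -, hy₀⟩ := isCompact_univ.exists_isMaxOn Set.univ_nonempty
      (hY.continuous hm).norm.continuousOn
    exact hω.ofReal.mul_bdd (c := ‖Y l m y₀‖) hc.aestronglyMeasurable
      (ae_of_all _ fun y => by simpa using hy₀ (Set.mem_univ y))
  have e1 : (coeff T Y l m ω).re = ∫ y, (conj (Y l m y)).re * T y ω ∂sigma := by
    refine (integral_re hint).symm.trans (integral_congr_ae (ae_of_all _ fun y => ?_))
    simp [mul_comm]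
  have e2 : (coeff T Y l m ω).im = ∫ y, (conj (Y l m y)).im * T y ω ∂sigma := by
    refine (integral_im hint).symm.trans (integral_congr_ae (ae_of_all _ fun y => ?_))
    simp [mul_comm]
  rw [← Complex.normSq_eq_norm_sq, Complex.normSq_apply, e1, e2]
  simp [sq]

lemma IsIsotropicGaussianField.integral_needletField_sq (hT : IsIsotropicGaussianField T P)
    (hY : IsSphericalHarmonicBasis Y) (b : ℝ → ℝ) (j : ℕ) (x : S2) :
    ∫ ω, needletField b T Y j x ω ^ 2 ∂P =
      ∫ ω, (∫ y, needletKernel b Y j x y * T y ω ∂sigma) ^ 2 ∂P := by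
  refine integral_congr_ae ?_
  filter_upwards [hT.ae_integrable] with ω hω
  rw [hY.needletField_eq_integral b j hω]

/-- By isotropy of `T` and rotation invariance of the kernel, the variance of the needlet field is
the same at all points of the sphere. -/
lemma IsIsotropicGaussianField.integral_needletField_sq_eq (hT : IsIsotropicGaussianField T P)
    (hY : IsSphericalHarmonicBasis Y) (b : ℝ → ℝ) (j : ℕ) (x y : S2) :
    ∫ ω, needletField b T Y j y ω ^ 2 ∂P = ∫ ω, needletField b T Y j x ω ^ 2 ∂P := by
  obtain ⟨v, hS⟩ := hT.exists_isStationaryGaussian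
  obtain ⟨g, hg, rfl⟩ := exists_isRotation_moveSphere_eq x y
  have hw : ∀ x, ∃ H, ∀ y, |needletKernel b Y j x y| ≤ H := fun x =>
    exists_abs_le_of_continuous (hY.continuous_needletKernel b j x)
  obtain ⟨H, hH⟩ := hw x
  obtain ⟨H', hH'⟩ := hw (moveSphere g x)
  rw [hT.integral_needletField_sq hY, hT.integral_needletField_sq hY,
    hS.integral_integral_sq (hY.continuous_needletKernel b j _).measurable hH,
    hS.integral_integral_sq (hY.continuous_needletKernel b j _).measurable hH',
    ← ((measurePreserving_moveSphere g).prod (measurePreserving_moveSphere g)).integral_comp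
      ((sphereHomeomorph g).prodCongr (sphereHomeomorph g)).measurableEmbedding]
  simp only [Prod.map_fst, Prod.map_snd, hY.needletKernel_moveSphere,
    hT.integral_mul_moveSphere hg]

/-- Parseval's identity for the band-limited field. -/
lemma IsSphericalHarmonicBasis.integral_norm_sum_sq (hY : IsSphericalHarmonicBasis Y)
    (s : Finset ℕ) (c : ℕ → ℤ → ℂ) :
    ∫ x, ‖∑ l ∈ s, ∑ m ∈ Finset.Icc (-(l : ℤ)) l, c l m * Y l m x‖ ^ 2 ∂sigma =
      ∑ l ∈ s, ∑ m ∈ Finset.Icc (-(l : ℤ)) l, ‖c l m‖ ^ 2 := by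
  let I : Finset (Σ _ : ℕ, ℤ) := s.sigma fun l => Finset.Icc (-(l : ℤ)) l
  let e : I → C(S2, ℂ) := fun p => ⟨Y p.1.1 p.1.2, hY.continuous (Finset.mem_sigma.1 p.2).2⟩
  have he : IsOrthonormalFamily e := by
    rintro ⟨⟨l, m⟩, hi⟩ ⟨⟨l', m'⟩, hj⟩
    refine (hY.orthonormal l m (Finset.mem_sigma.1 hi).2 l' m' (Finset.mem_sigma.1 hj).2).trans ?_
    simp
  have h := he.integral_norm_sum_sq fun p => c p.1.1 p.1.2
  have h1 : ∀ x, ∑ p : I, c p.1.1 p.1.2 * e p x =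
      ∑ l ∈ s, ∑ m ∈ Finset.Icc (-(l : ℤ)) l, c l m * Y l m x := by
    intro x
    rw [Finset.sum_sigma']
    exact Finset.sum_coe_sort I fun p => c p.1 p.2 * Y p.1 p.2 x
  simp only [h1] at h
  rw [h, Finset.sum_sigma']
  exact Finset.sum_coe_sort I fun p => ‖c p.1 p.2‖ ^ 2

/-- The common variance of the needlet field, computed as its average over the sphere, is at most
the normalizing variance, up to the factor `4π / σ(S²)`. -/
lemma IsIsotropicGaussianField.integral_needletField_sq_mul_le (hT : IsIsotropicGaussianField T P)
    (hY : IsSphericalHarmonicBasis Y) (b : ℝ → ℝ) (j : ℕ) (x : S2) :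
    (∫ ω, needletField b T Y j x ω ^ 2 ∂P) * sigma.real Set.univ ≤
      4 * Real.pi * needletVariance P b T Y j := by
  obtain ⟨v, hS⟩ := hT.exists_isStationaryGaussian
  have hmeas := hT.measurable_needletField hY b j
  have hsq : ∀ x, Integrable (fun ω => needletField b T Y j x ω ^ 2) P := by
    intro x
    obtain ⟨H, hH⟩ := exists_abs_le_of_continuous (hY.continuous_needletKernel b j x)
    refine (hS.memLp_integral (μ := sigma) (hY.continuous_needletKernel b j x).measurable
      hH).integrable_sq.congr ?_
    filter_upwards [hT.ae_integrable] with ω hω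
    rw [hY.needletField_eq_integral b j hω]
  have hint : Integrable (fun q : S2 × Ω => needletField b T Y j q.1 q.2 ^ 2) (sigma.prod P) := by
    rw [integrable_prod_iff (hmeas.pow_const 2).aestronglyMeasurable]
    refine ⟨ae_of_all _ hsq, ?_⟩
    simp only [norm_pow, Real.norm_eq_abs, sq_abs, hT.integral_needletField_sq_eq hY b j x]
    exact integrable_const _
  let s := Finset.Icc ((2 : ℕ) ^ (j - 1)) (2 ^ (j + 1))
  have hc : ∀ l ∈ s, ∀ m ∈ Finset.Icc (-(l : ℤ)) l, Integrable
      (fun ω => ‖(b ((l : ℝ) / 2 ^ j) : ℂ) * coeff T Y l m ω‖ ^ 2) P := by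
    intro l _ m hm
    simp only [norm_mul, mul_pow]
    exact (hT.integrable_norm_coeff_sq hY hm).const_mul _
  calc (∫ ω, needletField b T Y j x ω ^ 2 ∂P) * sigma.real Set.univ
      = ∫ y, ∫ ω, needletField b T Y j y ω ^ 2 ∂P ∂sigma := by
        simp only [hT.integral_needletField_sq_eq hY b j x, integral_const, smul_eq_mul, mul_comm]
    _ = ∫ ω, ∫ y, needletField b T Y j y ω ^ 2 ∂sigma ∂P := integral_integral_swap hint
    _ ≤ ∫ ω, ∑ l ∈ s, ∑ m ∈ Finset.Icc (-(l : ℤ)) l,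
          ‖(b ((l : ℝ) / 2 ^ j) : ℂ) * coeff T Y l m ω‖ ^ 2 ∂P := by
        refine integral_mono hint.integral_prod_right
          (integrable_finsetSum _ fun l hl => integrable_finsetSum _ (hc l hl)) fun ω => ?_
        simp only
        rw [← hY.integral_norm_sum_sq]
        have hcont : Continuous fun y => ∑ l ∈ s, ∑ m ∈ Finset.Icc (-(l : ℤ)) l,
            (b ((l : ℝ) / 2 ^ j) : ℂ) * coeff T Y l m ω * Y l m y :=
          continuous_finsetSum _ fun l _ => continuous_finsetSum _ fun m hm =>
            continuous_const.mul (hY.continuous hm)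
        refine integral_mono (integrable_of_continuous ((Complex.continuous_re.comp hcont).pow 2))
          (integrable_of_continuous (hcont.norm.pow 2)) fun y => ?_
        simp only
        rw [← sq_abs]
        exact pow_le_pow_left₀ (abs_nonneg _) (Complex.abs_re_le_norm _) 2
    _ = 4 * Real.pi * needletVariance P b T Y j := by
        rw [integral_finsetSum _ fun l hl => integrable_finsetSum _ (hc l hl), needletVariance,
          Finset.mul_sum]
        refine Finset.sum_congr rfl fun l hl => ?_
        rw [integral_finsetSum _ (hc l hl)]
        simp only [norm_mul, mul_pow, integral_const_mul, ← Finset.mul_sum, powerSpectrum]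
        rw [Complex.norm_real, Real.norm_eq_abs, sq_abs]
        have : (0 : ℝ) < 2 * l + 1 := by positivity
        field_simp

end Field

/-! ### The supremum of the normalized field -/

section Supremum

variable {Ω : Type*} [MeasurableSpace Ω] {P : Measure Ω} {T : S2 → Ω → ℝ} {Y : ℕ → ℤ → S2 → ℂ}

lemma sigma_real_univ_pos : 0 < sigma.real Set.univ := by
  rw [measureReal_def]
  exact ENNReal.toReal_pos (isOpen_univ.measure_pos sigma Set.univ_nonempty).ne'
    (measure_ne_top _ _)

lemma needletVariance_nonneg (b : ℝ → ℝ) (j : ℕ) : 0 ≤ needletVariance P b T Y j := by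
  unfold needletVariance powerSpectrum
  have : 0 < Real.pi := Real.pi_pos
  refine Finset.sum_nonneg fun l _ => mul_nonneg (by positivity) (div_nonneg ?_ (by positivity))
  exact Finset.sum_nonneg fun m _ => integral_nonneg fun ω => by positivity

/-- The trajectories of the normalized field are polynomials of degree at most `2 ^ (j + 1)`. This
holds for every `ω`, even where the integrals defining the coefficients diverge. -/
lemma IsSphericalHarmonicBasis.exists_polyRestrict_eq_normalizedField
    (hY : IsSphericalHarmonicBasis Y) (b : ℝ → ℝ) (j : ℕ) (ω : Ω) :
    ∃ r : MvPolynomial (Fin 3) ℂ, r.totalDegree ≤ 2 ^ (j + 1) ∧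
      ∀ x, polyRestrict r x = (normalizedField P b T Y j x ω : ℂ) := by
  obtain ⟨Q, hQ⟩ := hY.exists_polyRestrict
  let q : MvPolynomial (Fin 3) ℂ := ∑ l ∈ Finset.Icc ((2 : ℕ) ^ (j - 1)) (2 ^ (j + 1)),
    ∑ m ∈ Finset.Icc (-(l : ℤ)) l, ((b ((l : ℝ) / 2 ^ j) : ℂ) * coeff T Y l m ω) • Q l m
  have hq : q.totalDegree ≤ 2 ^ (j + 1) := by
    refine MvPolynomial.totalDegree_finsetSum_le fun l hl =>
      MvPolynomial.totalDegree_finsetSum_le fun m hm => ?_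
    exact (MvPolynomial.totalDegree_smul_le _ _).trans
      ((hQ l m hm).1.trans (Finset.mem_Icc.1 hl).2)
  have hqx : ∀ x, (polyRestrict q x).re = needletField b T Y j x ω := by
    intro x
    simp only [q, map_sum, map_smul, ContinuousMap.sum_apply, ContinuousMap.smul_apply,
      smul_eq_mul, needletField]
    refine congrArg Complex.re (Finset.sum_congr rfl fun l _ => Finset.sum_congr rfl fun m hm => ?_)
    rw [(hQ l m hm).2]
  obtain ⟨r, hr, hrx⟩ := exists_polyRestrict_eq_re q
  refine ⟨((√(needletVariance P b T Y j))⁻¹ : ℂ) • r,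
    (MvPolynomial.totalDegree_smul_le _ _).trans (hr.trans hq), fun x => ?_⟩
  rw [map_smul, ContinuousMap.smul_apply, hrx, hqx, normalizedField]
  push_cast
  rw [smul_eq_mul, div_eq_inv_mul]

lemma IsSphericalHarmonicBasis.continuous_normalizedField (hY : IsSphericalHarmonicBasis Y)
    (b : ℝ → ℝ) (j : ℕ) (ω : Ω) : Continuous fun x => normalizedField P b T Y j x ω := by
  obtain ⟨r, -, hr⟩ := hY.exists_polyRestrict_eq_normalizedField (P := P) (T := T) b j ω
  have : (fun x => normalizedField P b T Y j x ω) = fun x => (polyRestrict r x).re := by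
    ext x
    rw [hr, Complex.ofReal_re]
  rw [this]
  exact Complex.continuous_re.comp (polyRestrict r).continuous

lemma exists_iSup_eq_of_continuous {f : S2 → ℝ} (hf : Continuous f) : ∃ x, ⨆ y, f y = f x := by
  obtain ⟨x, -, hx⟩ := isCompact_univ.exists_isMaxOn Set.univ_nonempty hf.continuousOn
  exact ⟨x, le_antisymm (ciSup_le fun y => hx (Set.mem_univ y))
    (le_ciSup ⟨f x, by rintro _ ⟨y, rfl⟩; exact hx (Set.mem_univ y)⟩ x)⟩

lemma IsIsotropicGaussianField.measurable_normalizedField (hT : IsIsotropicGaussianField T P)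
    (hY : IsSphericalHarmonicBasis Y) (b : ℝ → ℝ) (j : ℕ) :
    Measurable fun q : S2 × Ω => normalizedField P b T Y j q.1 q.2 :=
  (hT.measurable_needletField hY b j).div_const _

lemma IsIsotropicGaussianField.measurable_iSup_normalizedField
    (hT : IsIsotropicGaussianField T P) (hY : IsSphericalHarmonicBasis Y) (b : ℝ → ℝ) (j : ℕ) :
    Measurable fun ω => ⨆ x, normalizedField P b T Y j x ω := by
  refine measurable_of_Iic fun a => ?_
  -- by continuity of the trajectories a dense sequence of points suffices
  have h : (fun ω => ⨆ x, normalizedField P b T Y j x ω) ⁻¹' Set.Iic a =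
      ⋂ n : ℕ, {ω | normalizedField P b T Y j (TopologicalSpace.denseSeq S2 n) ω ≤ a} := by
    ext ω
    have hc := hY.continuous_normalizedField (P := P) (T := T) b j ω
    simp only [Set.mem_preimage, Set.mem_Iic, Set.mem_iInter]
    constructor
    · intro h n
      exact (le_ciSup (isCompact_range hc).bddAbove _).trans h
    · intro h
      refine ciSup_le fun x => ?_
      have hcl : IsClosed {x | normalizedField P b T Y j x ω ≤ a} :=
        isClosed_le hc continuous_const
      have hd := (TopologicalSpace.denseRange_denseSeq S2).closure_eq
      exact closure_minimal (by rintro _ ⟨n, rfl⟩; exact h n) hcl (hd ▸ Set.mem_univ x)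
  have hm : ∀ x, Measurable fun ω => normalizedField P b T Y j x ω := fun x =>
    Measurable.of_uncurry_left (f := fun x ω => normalizedField P b T Y j x ω)
      (hT.measurable_normalizedField hY b j)
  rw [h]
  exact MeasurableSet.iInter fun n => hm _ measurableSet_Iic

/-- The Nikolskii inequality for a trajectory, at a point where the supremum is attained. -/
lemma IsSphericalHarmonicBasis.enorm_iSup_pow_mul_le (hY : IsSphericalHarmonicBasis Y)
    (b : ℝ → ℝ) (j k : ℕ) (ω : Ω) :
    ‖⨆ x, normalizedField P b T Y j x ω‖ₑ ^ (2 * k) * sigma Set.univ ≤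
      ENNReal.ofReal (((k * 2 ^ (j + 1) : ℕ) + 1 : ℝ) ^ 3) *
        ∫⁻ y, ‖normalizedField P b T Y j y ω‖ₑ ^ (2 * k) ∂sigma := by
  have hc := hY.continuous_normalizedField (P := P) (T := T) b j ω
  obtain ⟨x, hx⟩ := exists_iSup_eq_of_continuous hc
  obtain ⟨r, hr, hrx⟩ := hY.exists_polyRestrict_eq_normalizedField (P := P) (T := T) b j ω
  have h := norm_polyRestrict_pow_mul_le hr k x
  simp only [hrx, Complex.norm_real, Real.norm_eq_abs, Even.pow_abs ⟨k, two_mul k⟩] at h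
  rw [hx]
  simp only [enorm_pow_two_mul]
  rw [← ofReal_integral_eq_lintegral_ofReal (integrable_of_continuous
      (f := fun y => normalizedField P b T Y j y ω ^ (2 * k)) (hc.pow _))
    (ae_of_all _ fun y => Even.pow_nonneg ⟨k, two_mul k⟩ _), ← ENNReal.ofReal_mul (by positivity),
    ← ENNReal.ofReal_toReal (measure_ne_top sigma Set.univ),
    ← ENNReal.ofReal_mul (Even.pow_nonneg ⟨k, two_mul k⟩ _)]
  exact ENNReal.ofReal_le_ofReal h

variable [IsProbabilityMeasure P]

lemma IsIsotropicGaussianField.integral_normalizedField_sq_le (hT : IsIsotropicGaussianField T P)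
    (hY : IsSphericalHarmonicBasis Y) (b : ℝ → ℝ) (j : ℕ) (x : S2) :
    ∫ ω, normalizedField P b T Y j x ω ^ 2 ∂P ≤ 4 * Real.pi / sigma.real Set.univ := by
  have h := hT.integral_needletField_sq_mul_le hY b j x
  have hs := sigma_real_univ_pos
  have hpi := Real.pi_pos
  simp only [normalizedField, div_pow, Real.sq_sqrt (needletVariance_nonneg (P := P) b j),
    integral_div]
  rcases (needletVariance_nonneg (P := P) (T := T) (Y := Y) b j).eq_or_lt with h0 | h0
  -- when the normalizing variance vanishes, the normalized field is `0`
  · rw [← h0, div_zero]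
    positivity
  · rw [div_le_div_iff₀ h0 hs]
    exact h

lemma IsIsotropicGaussianField.lintegral_normalizedField_pow_le
    (hT : IsIsotropicGaussianField T P) (hY : IsSphericalHarmonicBasis Y) (b : ℝ → ℝ) (j : ℕ)
    (x : S2) {k : ℕ} (hk : 1 ≤ k) :
    ∫⁻ ω, ‖normalizedField P b T Y j x ω‖ₑ ^ (2 * k) ∂P ≤
      ENNReal.ofReal ((12 * k * (4 * Real.pi / sigma.real Set.univ)) ^ k) := by
  obtain ⟨v, hS⟩ := hT.exists_isStationaryGaussian
  have hc : Continuous fun y => needletKernel b Y j x y / √(needletVariance P b T Y j) :=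
    (hY.continuous_needletKernel b j x).div_const _
  obtain ⟨H, hH⟩ := exists_abs_le_of_continuous hc
  have hae : ∀ᵐ ω ∂P, normalizedField P b T Y j x ω =
      ∫ y, needletKernel b Y j x y / √(needletVariance P b T Y j) * T y ω ∂sigma := by
    filter_upwards [hT.ae_integrable] with ω hω
    rw [normalizedField, hY.needletField_eq_integral b j hω, ← integral_div]
    refine integral_congr_ae (ae_of_all _ fun y => ?_)
    simp only
    ring
  have h := hS.lintegral_integral_pow_le (μ := sigma) hc.measurable hH hk
  calc ∫⁻ ω, ‖normalizedField P b T Y j x ω‖ₑ ^ (2 * k) ∂P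
      = ∫⁻ ω, ‖∫ y, needletKernel b Y j x y / √(needletVariance P b T Y j) * T y ω ∂sigma‖ₑ
          ^ (2 * k) ∂P := by
        refine lintegral_congr_ae ?_
        filter_upwards [hae] with ω hω
        rw [hω]
    _ ≤ _ := h
    _ = ENNReal.ofReal ((12 * k : ℝ) ^ k * (∫ ω, normalizedField P b T Y j x ω ^ 2 ∂P) ^ k) := by
        congr 3
        refine integral_congr_ae ?_
        filter_upwards [hae] with ω hω
        rw [hω]
    _ ≤ _ := by
        rw [mul_pow _ (4 * Real.pi / sigma.real Set.univ)]
        refine ENNReal.ofReal_le_ofReal (mul_le_mul_of_nonneg_left ?_ (by positivity))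
        exact pow_le_pow_left₀ (integral_nonneg fun ω => sq_nonneg _)
          (hT.integral_normalizedField_sq_le hY b j x) k

/-- The moment of order `2j` of the supremum of the `j`-th field. The Nikolskii constant for
polynomials of degree `j 2 ^ (j + 1)` is at most `8 ^ (3j)`, so that it contributes only a constant
factor to the `L^{2j}` norm. -/
lemma IsIsotropicGaussianField.lintegral_iSup_pow_le (hT : IsIsotropicGaussianField T P)
    (hY : IsSphericalHarmonicBasis Y) (b : ℝ → ℝ) {j : ℕ} (hj : 1 ≤ j) :
    ∫⁻ ω, ‖⨆ x, normalizedField P b T Y j x ω‖ₑ ^ (2 * j) ∂P ≤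
      ENNReal.ofReal ((512 * 12 * (4 * Real.pi / sigma.real Set.univ) * j) ^ j) := by
  have hs := sigma_real_univ_pos
  have hpi := Real.pi_pos
  have hK : ((j * 2 ^ (j + 1) : ℕ) + 1 : ℝ) ^ 3 ≤ 512 ^ j := by
    have h1 : j * 2 ^ (j + 1) + 1 ≤ 8 ^ j := by
      have h2 : j + 1 ≤ 2 ^ j := Nat.lt_two_pow_self
      have h3 : 2 ≤ 2 ^ j := by
        calc 2 = 2 ^ 1 := rfl
          _ ≤ 2 ^ j := Nat.pow_le_pow_right (by norm_num) hj
      calc j * 2 ^ (j + 1) + 1 ≤ (j + 1) * 2 ^ (j + 1) := by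
            nlinarith [Nat.one_le_two_pow (n := j + 1)]
        _ ≤ 2 ^ j * 2 ^ (j + 1) := Nat.mul_le_mul_right _ h2
        _ = 2 ^ j * 2 ^ j * 2 := by ring
        _ ≤ 2 ^ j * 2 ^ j * 2 ^ j := Nat.mul_le_mul_left _ h3
        _ = 8 ^ j := by rw [← mul_pow, ← mul_pow]; norm_num
    calc ((j * 2 ^ (j + 1) : ℕ) + 1 : ℝ) ^ 3 ≤ ((8 : ℝ) ^ j) ^ 3 := by
          gcongr
          exact_mod_cast h1
      _ = 512 ^ j := by rw [← pow_mul, mul_comm, pow_mul]; norm_num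
  have hmeas := (hT.measurable_normalizedField hY b j).enorm.pow_const (2 * j)
  have hmul : (∫⁻ ω, ‖⨆ x, normalizedField P b T Y j x ω‖ₑ ^ (2 * j) ∂P) * sigma Set.univ ≤
      ENNReal.ofReal ((512 * 12 * (4 * Real.pi / sigma.real Set.univ) * j) ^ j) *
        sigma Set.univ := by
    calc (∫⁻ ω, ‖⨆ x, normalizedField P b T Y j x ω‖ₑ ^ (2 * j) ∂P) * sigma Set.univ
        = ∫⁻ ω, ‖⨆ x, normalizedField P b T Y j x ω‖ₑ ^ (2 * j) * sigma Set.univ ∂P :=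
          (lintegral_mul_const' _ _ (measure_ne_top _ _)).symm
      _ ≤ ∫⁻ ω, ENNReal.ofReal (512 ^ j) *
            ∫⁻ y, ‖normalizedField P b T Y j y ω‖ₑ ^ (2 * j) ∂sigma ∂P := by
          refine lintegral_mono fun ω => (hY.enorm_iSup_pow_mul_le b j j ω).trans ?_
          gcongr
      _ = ENNReal.ofReal (512 ^ j) *
            ∫⁻ y, ∫⁻ ω, ‖normalizedField P b T Y j y ω‖ₑ ^ (2 * j) ∂P ∂sigma := by
          rw [lintegral_const_mul' _ _ ENNReal.ofReal_ne_top,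
            
            lintegral_lintegral_swap (f := fun ω y => ‖normalizedField P b T Y j y ω‖ₑ ^ (2 * j))
              (hmeas.comp measurable_swap).aemeasurable]
      _ ≤ ENNReal.ofReal (512 ^ j) * ∫⁻ _, ENNReal.ofReal
            ((12 * j * (4 * Real.pi / sigma.real Set.univ)) ^ j) ∂sigma := by
          gcongr with y
          exact hT.lintegral_normalizedField_pow_le hY b j y hj
      _ = _ := by
          rw [lintegral_const, ← mul_assoc, ← ENNReal.ofReal_mul (by positivity), ← mul_pow]
          congr 3
          ring
  exact (ENNReal.mul_le_mul_iff_left (isOpen_univ.measure_pos sigma Set.univ_nonempty).ne'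
    (measure_ne_top _ _)).1 hmul

end Supremum

/-! ### From moments of order `2j` to expectations and almost sure bounds -/

section Moments

variable {Ω : Type*} [MeasurableSpace Ω] {P : Measure Ω}

lemma integral_le_two_mul_of_lintegral_pow_le [IsProbabilityMeasure P] {S : Ω → ℝ}
    (hS : Measurable S) {r : ℝ} (hr : 0 < r) {k : ℕ} (hk : 1 ≤ k)
    (h : ∫⁻ ω, ‖S ω‖ₑ ^ (2 * k) ∂P ≤ ENNReal.ofReal ((r ^ 2) ^ k)) :
    Integrable S P ∧ ∫ ω, S ω ∂P ≤ 2 * r := by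
  simp only [enorm_pow_two_mul] at h
  have hnn : ∀ ω, 0 ≤ S ω ^ (2 * k) := fun ω => Even.pow_nonneg ⟨k, two_mul k⟩ _
  have hint : Integrable (fun ω => S ω ^ (2 * k)) P := by
    refine ⟨(hS.pow_const _).aestronglyMeasurable, ?_⟩
    rw [hasFiniteIntegral_iff_ofReal (ae_of_all _ hnn)]
    exact h.trans_lt ENNReal.ofReal_lt_top
  have hle : ∫ ω, S ω ^ (2 * k) ∂P ≤ r ^ (2 * k) := by
    rw [← ofReal_integral_eq_lintegral_ofReal hint (ae_of_all _ hnn),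
      ENNReal.ofReal_le_ofReal_iff (by positivity), ← pow_mul] at h
    exact h
  have hint2 : Integrable (fun ω => r * (1 + S ω ^ (2 * k) / r ^ (2 * k))) P :=
    ((integrable_const _).add (hint.div_const _)).const_mul _
  have hbd : ∀ ω, |S ω| ≤ r * (1 + S ω ^ (2 * k) / r ^ (2 * k)) := by
    intro ω
    rw [← Even.pow_abs ⟨k, two_mul k⟩, ← div_pow]
    have hx : 0 ≤ |S ω| / r := by positivity
    have hy : |S ω| / r ≤ 1 + (|S ω| / r) ^ (2 * k) := by
      rcases le_total (|S ω| / r) 1 with h1 | h1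
      · linarith [pow_nonneg hx (2 * k)]
      · linarith [le_self_pow₀ h1 (n := 2 * k) (by omega)]
    calc |S ω| = r * (|S ω| / r) := by field_simp
      _ ≤ _ := by gcongr
  refine ⟨hint2.mono' hS.aestronglyMeasurable (ae_of_all _ hbd), ?_⟩
  calc ∫ ω, S ω ∂P ≤ ∫ ω, r * (1 + S ω ^ (2 * k) / r ^ (2 * k)) ∂P :=
        integral_mono (hint2.mono' hS.aestronglyMeasurable (ae_of_all _ hbd)) hint2
          fun ω => (le_abs_self _).trans (hbd ω)
    _ = r * (1 + (∫ ω, S ω ^ (2 * k) ∂P) / r ^ (2 * k)) := by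
        rw [integral_const_mul, integral_add (integrable_const _) (hint.div_const _),
          integral_div]
        simp
    _ ≤ r * (1 + 1) := by
        gcongr
        exact (div_le_one (by positivity)).2 hle
    _ = 2 * r := by ring

/-- Markov's inequality for the moment of order `2k`. -/
lemma measure_two_mul_le_of_lintegral_pow_le {S : Ω → ℝ} (hS : Measurable S) {r : ℝ} (hr : 0 < r)
    {k : ℕ} (h : ∫⁻ ω, ‖S ω‖ₑ ^ (2 * k) ∂P ≤ ENNReal.ofReal ((r ^ 2) ^ k)) :
    P {ω | 2 * r ≤ S ω} ≤ ENNReal.ofReal ((1 / 4) ^ k) := by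
  have hpos : 0 < (2 * r) ^ (2 * k) := by positivity
  have h1 := meas_ge_le_lintegral_div (μ := P) (hS.enorm.pow_const (2 * k)).aemeasurable
    (ε := ENNReal.ofReal ((2 * r) ^ (2 * k))) (by simpa using hpos) ENNReal.ofReal_ne_top
  refine (measure_mono fun ω (hω : 2 * r ≤ S ω) => ?_).trans
    (h1.trans ((ENNReal.div_le_div_right h _).trans ?_))
  · rw [Set.mem_ofPred_eq, enorm_pow_two_mul]
    exact ENNReal.ofReal_le_ofReal (pow_le_pow_left₀ (by positivity) hω _)
  · rw [← ENNReal.ofReal_div_of_pos hpos, pow_mul (2 * r), ← div_pow]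
    refine ENNReal.ofReal_le_ofReal (le_of_eq ?_)
    congr 1
    field_simp
    norm_num

/-- If the `2j`-th moment of `S j` is at most `(B j) ^ j`, then almost surely `S j < 2 √(B j)` for
all large `j`: by Markov's inequality the exceptional events have probability at most `4 ^ (-j)`. -/
lemma ae_eventually_lt_of_lintegral_pow_le {S : ℕ → Ω → ℝ} (hS : ∀ j, Measurable (S j)) {B : ℝ}
    (hB : 0 < B) (h : ∀ j : ℕ, 1 ≤ j →
      ∫⁻ ω, ‖S j ω‖ₑ ^ (2 * j) ∂P ≤ ENNReal.ofReal ((B * j) ^ j)) :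
    ∀ᵐ ω ∂P, ∀ᶠ j in atTop, S j ω < 2 * √(B * j) := by
  have hsum : ∑' j : ℕ, P {ω | 1 ≤ j ∧ 2 * √(B * j) ≤ S j ω} ≠ ⊤ := by
    refine ne_top_of_le_ne_top ?_ (ENNReal.tsum_le_tsum
      (g := fun j : ℕ => ENNReal.ofReal ((1 / 4 : ℝ) ^ j)) fun j => ?_)
    · rw [← ENNReal.ofReal_tsum_of_nonneg (fun j => by positivity)
        (summable_geometric_of_lt_one (by norm_num) (by norm_num))]
      exact ENNReal.ofReal_ne_top
    · by_cases hj : 1 ≤ j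
      · have hj0 : (0 : ℝ) < j := by exact_mod_cast hj
        simp only [hj, true_and]
        refine measure_two_mul_le_of_lintegral_pow_le (hS j) (by positivity) ?_
        rw [Real.sq_sqrt (by positivity)]
        exact h j hj
      · simp [hj]
  filter_upwards [ae_eventually_notMem hsum] with ω hω
  filter_upwards [hω, eventually_ge_atTop 1] with j hj h1
  by_contra hcon
  exact hj ⟨h1, not_lt.1 hcon⟩

end Moments

end SphericalField

end

theorem proposition1 {Ω : Type*} [MeasurableSpace Ω] (P : Measure Ω) [IsProbabilityMeasure P]
    (T : SphericalField.S2 → Ω → ℝ) (hT : SphericalField.IsIsotropicGaussianField T P)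
    (Y : ℕ → ℤ → SphericalField.S2 → ℂ) (hY : SphericalField.IsSphericalHarmonicBasis Y)
    (hC : SphericalField.HasRegularSpectrum (SphericalField.powerSpectrum P T Y))
    (b : ℝ → ℝ) (hb : ContDiff ℝ ((⊤ : ℕ∞) : WithTop ℕ∞) b) (hbs : tsupport b ⊆ Set.Icc (1 / 2) 2) :
    (∃ c : ℝ, 0 < c ∧ ∀ j : ℕ, 1 ≤ j →
      Integrable (fun ω => ⨆ x, SphericalField.normalizedField P b T Y j x ω) P ∧
      ∫ ω, (⨆ x, SphericalField.normalizedField P b T Y j x ω) ∂P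
        ≤ c * √(4 * Real.log (2 ^ j))) ∧
    (∃ C : ℝ, 0 < C ∧ ∀ᵐ ω ∂P,
      limsup (fun j : ℕ =>
        (((⨆ x, SphericalField.normalizedField P b T Y j x ω) / √(4 * Real.log (2 ^ j)) : ℝ) :
          EReal)) atTop ≤ ((C + 1 / √2 : ℝ) : EReal)) := by
  obtain ⟨B, hB, hmom⟩ : ∃ B : ℝ, 0 < B ∧ ∀ j : ℕ, 1 ≤ j →
      ∫⁻ ω, ‖⨆ x, SphericalField.normalizedField P b T Y j x ω‖ₑ ^ (2 * j) ∂P ≤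
        ENNReal.ofReal ((B * j) ^ j) :=
    ⟨_, by have := SphericalField.sigma_real_univ_pos; have := Real.pi_pos; positivity,
      fun j hj => hT.lintegral_iSup_pow_le hY b hj⟩
  have hmeas := fun j => hT.measurable_iSup_normalizedField hY b j
  have hlog : 0 < Real.log 2 := Real.log_pos one_lt_two
  -- chosen so that `c √(4 log 2 ^ j) = 2 √(B j)`
  set c := 2 * √(B / (4 * Real.log 2)) with hc
  have hc0 : 0 < c := by positivity
  have hcj : ∀ j : ℕ, c * √(4 * Real.log (2 ^ j)) = 2 * √(B * j) := by
    intro j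
    rw [hc, mul_assoc, ← Real.sqrt_mul (by positivity), Real.log_pow]
    congr 2
    field_simp
  refine ⟨⟨c, hc0, fun j hj => ?_⟩, c, hc0, ?_⟩
  · have hj0 : (0 : ℝ) < j := by exact_mod_cast hj
    rw [hcj]
    refine SphericalField.integral_le_two_mul_of_lintegral_pow_le (hmeas j) (by positivity) hj ?_
    rw [Real.sq_sqrt (by positivity)]
    exact hmom j hj
  · filter_upwards [SphericalField.ae_eventually_lt_of_lintegral_pow_le hmeas hB hmom] with ω hω
    refine limsup_le_of_le (by isBoundedDefault) ?_
    filter_upwards [hω, eventually_ge_atTop 1] with j hj h1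
    rw [EReal.coe_le_coe_iff]
    have hpos : 0 < √(4 * Real.log (2 ^ j)) := by
      have : (0 : ℝ) < j := by exact_mod_cast h1
      rw [Real.log_pow]
      positivity
    rw [← hcj] at hj
    have h2 : 0 ≤ 1 / √2 := by positivity
    exact ((div_le_iff₀ hpos).2 hj.le).trans (le_add_of_nonneg_right h2)
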